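/- Notation. Let $\mathcal H$ be the upper half-plane, $q^n=\mathbf e(n\tau)=e^{2\pi i n\tau}$, $y=\operatorname{Im}\tau$. $Mp_2(\mathbb Z)$ is the group of pairs $(\alpha,\phi)$ with $\alpha=\begin{pmatrix}a&b\\c&d\end{pmatrix}\in SL_2(\mathbb Z)$ and $\phi:\mathcal H\to\mathbb C$ holomorphic with $\phi(\tau)^2=c\tau+d$, with product $(\alpha,\phi(\tau))(\beta,\varphi(\tau))=(\alpha\beta,\phi(\beta\tau)\varphi(\tau))$. $\widetilde\Gamma_0(N),\widetilde\Gamma_1(N)$ are the inverse images in $Mp_2(\mathbb Z)$ of $\Gamma_0(N),\Gamma_1(N)$, and $\widetilde\Gamma_N=\widetilde\Gamma_0(4N)\cap\widetilde\Gamma_1(N)$. On $\widetilde\Gamma_0(4)$ let $\psi(\alpha,\pm\sqrt{c\tau+d})=\pm\left(\frac cd\right)\overline{\varepsilon_d}$, where the root is the principal one, $\varepsilon_d$ is $1$ or $i$ according as $d\equiv1$ or $3\pmod 4$, and $\left(\frac cd\right)$ is the Jacobi symbol $\left(\frac c{|d|}\right)$, multiplied by $-1$ if $c<0$ and $d<0$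 (with $\left(\frac0{\pm1}\right)=1$). Let $\rho_1$ be the Weil representation of $Mp_2(\mathbb Z)$ on $\mathbb C\mathfrak e_0\oplus\mathbb C\mathfrak e_1$ attached to the rank one lattice generated by a vector of norm $2$, i.e. the representation with $$\rho_1\left(\begin{pmatrix}1&1\\0&1\end{pmatrix},1\right)=\begin{pmatrix}1&0\\0&i\end{pmatrix},\qquad \rho_1\left(\begin{pmatrix}0&-1\\1&0\end{pmatrix},\sqrt\tau\right)=\frac{1-i}2\begin{pmatrix}1&1\\1&-1\end{pmatrix},$$ and let $\rho_{-1}=\overline{\rho_1}\cong\rho_1^*$ be the conjugate (dual) representation, with basis denoted $\mathfrak e_0,\mathfrak e_{-1}$. For a subgroup $\widetilde\Gamma\subseteq Mp_2(\mathbb Z)$, a representation $\rho$ of $\widetilde\Gamma$ on a finite-dimensional complex vector space $V$, and $\kappa\in\frac12\mathbb Z$, let $\mathcal A_\kappa(\widetilde\Gamma,\rho)$ be the space of real-analytic $f:\mathcal H\to V$ with $f(\alpha\tau)=\phi(\tau)^{2\kappa}\rho(\alpha,\phi)f(\tau)$ for all $(\alpha,\phi)\in\widetilde\Gamma$. A Dirichlet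 character is evaluated on $(\alpha,\phi)$ through the lower right entry $d$ of $\alpha$. For a Dirichlet character $\chi$ modulo $N$ let $\omega_\chi(d)=\left(\frac{4\chi(-1)}d\right)\chi(d)$, a character modulo $4N$ (here $\left(\frac{4}{\cdot}\right)$ and $\left(\frac{-4}{\cdot}\right)$ are the trivial and the non-trivial character modulo $4$). Let $N,k$ be positive integers, $\xi\in\{\pm1\}$ and $\varepsilon=(-1)^k\xi$. Let $\mathcal A^+_{k+1/2}(\widetilde\Gamma_N,\psi^{2k+\xi})$ be the space of those $f=\sum_{n\in\mathbb Z}c_n(y)q^n\in\mathcal A_{k+1/2}(\widetilde\Gamma_N,\psi^{2k+\xi})$ with $c_n(y)=0$ for all $y>0$ unless $(-1)^k\xi n\equiv0,1\pmod4$, where $c_n(y)=\int_0^1f(x+iy)\mathbf e(-n(x+iy))\,dx$. For a Dirichlet character $\chi$ modulo $N$ with $\chi(-1)=\xi$ put $$\mathcal A^+_{k+1/2}(\widetilde\Gamma_0(4N),\psi^{2k+1}\omega_\chi)=\mathcal A_{k+1/2}(\widetilde\Gamma_0(4N),\psi^{2k+1}\omega_\chi)\cap\mathcal A^+_{k+1/2}(\widetilde\Gamma_N,\psi^{2k+\xi}).$$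 For $f$ in the plus-space and $j\in\mathbb Z/4\mathbb Z$ let $f_j(\tau)=\sum_{n\equiv j\,(4)}c_n\left(\frac y4\right)q^{n/4}$, and let $\mathcal L_\varepsilon f=f_0\,\mathfrak e_0+f_\varepsilon\,\mathfrak e_\varepsilon$. Theorem. For every $f\in\mathcal A^+_{k+1/2}(\widetilde\Gamma_N,\psi^{2k+\xi})$ the Fourier series $\sum_n c_n(y)q^n$ converges absolutely to $f$, and the series defining the $f_j$ converge absolutely. The map $f\mapsto\mathcal L_\varepsilon f$ is a $\mathbb C$-linear isomorphism from $\mathcal A^+_{k+1/2}(\widetilde\Gamma_N,\psi^{2k+\xi})$ onto $\mathcal A_{k+1/2}(\widetilde\Gamma_1(N),\rho_\varepsilon)$. Moreover, for every Dirichlet character $\chi$ modulo $N$ with $\chi(-1)=\xi$, the image of $\mathcal A^+_{k+1/2}(\widetilde\Gamma_0(4N),\psi^{2k+1}\omega_\chi)$ under $\mathcal L_\varepsilon$ is exactly $\mathcal A_{k+1/2}(\widetilde\Gamma_0(N),\chi\otimes\rho_\varepsilon)$. -/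

import Mathlib

noncomputable section

namespace HalfIntegral

open Complex Matrix
open UpperHalfPlane hiding I
open scoped MatrixGroups ComplexConjugate

/-- The factor of automorphy `j(α, τ) = c τ + d`. -/
def j (α : SL(2, ℤ)) (τ : ℍ) : ℂ := ((α 1 0 : ℤ) : ℂ) * (τ : ℂ) + ((α 1 1 : ℤ) : ℂ)

theorem j_eq_denom (α : SL(2, ℤ)) (τ : ℍ) : j α τ = denom (α : GL (Fin 2) ℝ) τ := by
  simp [j, ModularGroup.denom_apply]

theorem j_ne_zero (α : SL(2, ℤ)) (τ : ℍ) : j α τ ≠ 0 := by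
  rw [j_eq_denom]; exact denom_ne_zero _ _

theorem j_mul (α β : SL(2, ℤ)) (τ : ℍ) : j (α * β) τ = j α (β • τ) * j β τ := by
  rw [j_eq_denom, j_eq_denom, j_eq_denom]
  have h := denom_cocycle_σ (α : GL (Fin 2) ℝ) (β : GL (Fin 2) ℝ) τ
  simpa [σ] using h

/-- The metaplectic group `Mp₂(ℤ)`: pairs `(α, φ)` with `α ∈ SL₂(ℤ)` and `φ` a holomorphic function
on the upper half-plane such that `φ(τ)² = j(α, τ)`. -/
@[ext] structure Mp2Z where
  mat : SL(2, ℤ)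
  phi : ℍ → ℂ
  holo : MDifferentiable (modelWithCornersSelf ℂ ℂ) (modelWithCornersSelf ℂ ℂ) phi
  sq_phi : ∀ τ, phi τ ^ 2 = j mat τ

namespace Mp2Z

theorem phi_ne_zero (A : Mp2Z) (τ : ℍ) : A.phi τ ≠ 0 := by
  intro h
  have := A.sq_phi τ
  rw [h] at this
  exact j_ne_zero _ _ (by simpa using this.symm)

theorem mdifferentiable_smul_SL (α : SL(2, ℤ)) :
    MDifferentiable (modelWithCornersSelf ℂ ℂ) (modelWithCornersSelf ℂ ℂ)
      (fun τ : ℍ => α • τ) :=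
  mdifferentiable_smul (g := (α : GL (Fin 2) ℝ)) (by simp)

/-- `(α, φ(τ)) (β, ϕ(τ)) = (α β, φ(β τ) ϕ(τ))`. -/
instance : Mul Mp2Z where
  mul A B :=
    { mat := A.mat * B.mat
      phi := fun τ => A.phi (B.mat • τ) * B.phi τ
      holo := (A.holo.comp (mdifferentiable_smul_SL B.mat)).mul B.holo
      sq_phi := fun τ => by rw [mul_pow, A.sq_phi, B.sq_phi, j_mul] }

instance : One Mp2Z where
  one :=
    { mat := 1
      phi := fun _ => 1
      holo := mdifferentiable_const
      sq_phi := fun τ => by simp [j] }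

instance : Inv Mp2Z where
  inv A :=
    { mat := A.mat⁻¹
      phi := fun τ => (A.phi (A.mat⁻¹ • τ))⁻¹
      holo := by
        have h := A.holo.comp (mdifferentiable_smul_SL A.mat⁻¹)
        rw [mdifferentiable_iff] at h ⊢
        exact h.inv fun z _ => A.phi_ne_zero _
      sq_phi := fun τ => by
        have h := j_mul A.mat A.mat⁻¹ τ
        rw [mul_inv_cancel] at h
        have h1 : j 1 τ = 1 := by simp [j]
        rw [inv_pow, A.sq_phi]
        exact inv_eq_of_mul_eq_one_right (by rw [← h, h1]) }

@[simp] theorem mul_mat (A B : Mp2Z) : (A * B).mat = A.mat * B.mat := rfl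
@[simp] theorem mul_phi (A B : Mp2Z) (τ : ℍ) :
    (A * B).phi τ = A.phi (B.mat • τ) * B.phi τ := rfl
@[simp] theorem one_mat : (1 : Mp2Z).mat = 1 := rfl
@[simp] theorem one_phi (τ : ℍ) : (1 : Mp2Z).phi τ = 1 := rfl
@[simp] theorem inv_mat (A : Mp2Z) : (A⁻¹).mat = A.mat⁻¹ := rfl
@[simp] theorem inv_phi (A : Mp2Z) (τ : ℍ) : (A⁻¹).phi τ = (A.phi (A.mat⁻¹ • τ))⁻¹ := rfl

instance : Group Mp2Z :=
  Group.ofLeftAxioms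
    (fun A B C => by
      ext τ <;> simp [mul_assoc, mul_smul])
    (fun A => by ext τ <;> simp)
    (fun A => by
      ext τ <;> simp [A.phi_ne_zero])

/-- The projection `Mp₂(ℤ) → SL₂(ℤ)`. -/
def toSL : Mp2Z →* SL(2, ℤ) where
  toFun := mat
  map_one' := rfl
  map_mul' _ _ := rfl

/-- `T = ((1 1; 0 1), 1)`. -/
def T : Mp2Z where
  mat := ModularGroup.T
  phi := fun _ => 1
  holo := mdifferentiable_const
  sq_phi := fun τ => by simp [j, ModularGroup.T]

/-- `S = ((0 -1; 1 0), √τ)`, with the principal branch of the square root. -/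
def S : Mp2Z where
  mat := ModularGroup.S
  phi := fun τ => (τ : ℂ) ^ (1 / 2 : ℂ)
  holo := by
    rw [mdifferentiable_iff]
    refine DifferentiableOn.congr (f := fun z : ℂ => z ^ (1 / 2 : ℂ)) ?_ ?_
    · intro z hz
      exact (DifferentiableAt.cpow_const differentiableAt_id
        (Or.inr (ne_of_gt hz))).differentiableWithinAt
    · intro z hz
      simp only [Function.comp_apply]
      rw [ofComplex_apply_of_im_pos hz]
  sq_phi := fun τ => by
    rw [← cpow_nat_mul]; simp [j, ModularGroup.S]

end Mp2Z

/-! ### Existence of the Weil representation, through the transformation law of a theta vector -/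

/-- `∑ q^{n²}` and `∑ q^{(n+1/2)²}`. -/
def thetaVec (τ : ℍ) : Fin 2 → ℂ :=
  ![jacobiTheta₂ 0 (2 * τ), cexp (Real.pi * I * τ / 2) * jacobiTheta₂ τ (2 * τ)]

theorem theta_split (z : ℂ) (τ : ℂ) (hτ : 0 < τ.im) :
    jacobiTheta₂ z (τ / 2) = jacobiTheta₂ (2 * z) (2 * τ)
      + cexp (2 * Real.pi * I * z + Real.pi * I * τ / 2) *
        jacobiTheta₂ (2 * z + τ) (2 * τ) := by
  have h2 : 0 < (2 * τ).im := by simpa using hτ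
  have h3 : 0 < (τ / 2).im := by simpa using hτ
  have h0 := (hasSum_jacobiTheta₂_term z h3).summable
  have he : Function.Injective (fun n : ℤ => 2 * n) := fun a b h => by simpa using h
  have ho : Function.Injective (fun n : ℤ => 2 * n + 1) := fun a b h => by simpa using h
  have hc : IsCompl (Set.range fun n : ℤ => 2 * n) (Set.range fun n : ℤ => 2 * n + 1)  := by
    have := Int.isCompl_even_odd
    have e : (Set.range fun n : ℤ => 2 * n) = {n | Even n} := by
      ext n; simp [even_iff_exists_two_mul]
    have o : (Set.range fun n : ℤ => 2 * n + 1) = {n | Odd n} := by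
      ext n; simp [Odd]
    rwa [e, o]
  have h1 : HasSum (fun n : ℤ => jacobiTheta₂_term (2 * n) z (τ / 2))
      (jacobiTheta₂ (2 * z) (2 * τ)) := by
    refine (hasSum_jacobiTheta₂_term (2 * z) h2).congr_fun fun n => ?_
    simp only [jacobiTheta₂_term]
    congr 1; push_cast; ring
  have h4 : HasSum (fun n : ℤ => jacobiTheta₂_term (2 * n + 1) z (τ / 2))
      (cexp (2 * Real.pi * I * z + Real.pi * I * τ / 2) *
        jacobiTheta₂ (2 * z + τ) (2 * τ)) := by
    refine ((hasSum_jacobiTheta₂_term (2 * z + τ) h2).mul_left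
      (cexp (2 * Real.pi * I * z + Real.pi * I * τ / 2))).congr_fun fun n => ?_
    simp only [jacobiTheta₂_term]
    rw [← Complex.exp_add]
    congr 1; push_cast; ring
  have h5 := (he.hasSum_range_iff (f := fun n : ℤ => jacobiTheta₂_term n z (τ / 2))).mpr h1
  have h6 := (ho.hasSum_range_iff (f := fun n : ℤ => jacobiTheta₂_term n z (τ / 2))).mpr h4
  exact (hasSum_jacobiTheta₂_term z h3).unique (h5.add_isCompl hc h6)

theorem sqrt_factor (τ : ℍ) :
    (-I * ((τ : ℂ) / 2)) ^ (1 / 2 : ℂ) = (τ : ℂ) ^ (1 / 2 : ℂ) * ((1 - I) / 2) := by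
  have hsq : ((τ : ℂ) ^ (1 / 2 : ℂ)) ^ 2 = τ := by rw [← cpow_nat_mul]; simp
  have hx : ((τ : ℂ) ^ (1 / 2 : ℂ) * ((1 - I) / 2)) ^ 2 = -I * ((τ : ℂ) / 2) := by
    rw [mul_pow, hsq]
    have : ((1 - I) / 2) ^ 2 = -I / 2 := by
      ring_nf; rw [I_sq]; ring
    rw [this]; ring
  have hre : 0 < ((τ : ℂ) ^ (1 / 2 : ℂ) * ((1 - I) / 2)).re := by
    have harg : 0 < (τ : ℂ).arg ∧ (τ : ℂ).arg < Real.pi := by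
      refine ⟨lt_of_le_of_ne (arg_nonneg_iff.mpr τ.im_pos.le) ?_,
        lt_of_le_of_ne (arg_le_pi _) ?_⟩
      · intro h
        have := (arg_eq_zero_iff.mp h.symm).2
        exact τ.im_ne_zero this
      · intro h
        exact τ.im_ne_zero (arg_eq_pi_iff.mp h).2
    have hre1 : 0 < ((τ : ℂ) ^ (1 / 2 : ℂ)).re := by
      rw [cpow_def_of_ne_zero τ.ne_zero, exp_re]
      refine mul_pos (Real.exp_pos _) (Real.cos_pos_of_mem_Ioo ?_)
      simp [log_im]
      constructor <;> linarith [harg.1, harg.2, Real.pi_pos]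
    have him1 : 0 < ((τ : ℂ) ^ (1 / 2 : ℂ)).im := by
      rw [cpow_def_of_ne_zero τ.ne_zero, exp_im]
      refine mul_pos (Real.exp_pos _) (Real.sin_pos_of_mem_Ioo ?_)
      simp [log_im]
      constructor <;> linarith [harg.1, harg.2, Real.pi_pos]
    rw [mul_re]
    simp
    linarith
  have := Complex.sq_cpow_two_inv hre
  rw [hx] at this
  simpa using this

/-- `ρ₁(T)`. -/
def weilT : Matrix (Fin 2) (Fin 2) ℂ := !![1, 0; 0, I]

/-- `ρ₁(S)`. -/
def weilS : Matrix (Fin 2) (Fin 2) ℂ := ((1 - I) / 2) • !![1, 1; 1, -1]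

theorem thetaVec_T (τ : ℍ) : thetaVec (ModularGroup.T • τ) = weilT *ᵥ thetaVec τ := by
  have h : ((ModularGroup.T • τ : ℍ) : ℂ) = τ + 1 := by
    rw [modular_T_smul]; simp [add_comm]
  ext i
  fin_cases i
  · simp only [thetaVec, weilT, h]
    simp [mul_add, jacobiTheta₂_add_right]
  · have : cexp (Real.pi * I * (τ + 1) / 2) = I * cexp (Real.pi * I * τ / 2) := by
      have : (Real.pi * I * (τ + 1) / 2 : ℂ) = Real.pi / 2 * I + Real.pi * I * τ / 2 := by ring
      rw [this, Complex.exp_add, exp_pi_div_two_mul_I]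
    simp only [thetaVec, weilT, h, this]
    simp [mul_add, jacobiTheta₂_add_right, jacobiTheta₂_add_left]
    ring

theorem thetaVec_S (τ : ℍ) : thetaVec (ModularGroup.S • τ)
    = ((τ : ℂ) ^ (1 / 2 : ℂ)) • weilS *ᵥ thetaVec τ := by
  have h : ((ModularGroup.S • τ : ℍ) : ℂ) = -1 / τ := by
    rw [modular_S_smul]; simp [neg_div, inv_neg]
  have hτ := τ.ne_zero
  have hs := sqrt_factor τ
  have hne : (-I * ((τ : ℂ) / 2)) ^ (1 / 2 : ℂ) ≠ 0 := by
    rw [Ne, cpow_eq_zero_iff, not_and_or]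
    exact Or.inl (mul_ne_zero (neg_ne_zero.mpr I_ne_zero) (div_ne_zero hτ two_ne_zero))
  have e0 := jacobiTheta₂_functional_equation 0 ((τ : ℂ) / 2)
  have e1 := jacobiTheta₂_functional_equation (-1 / 2) ((τ : ℂ) / 2)
  rw [theta_split _ _ τ.im_pos] at e0 e1
  have a1 : (-1 / ((τ : ℂ) / 2)) = 2 * (-1 / τ) := by field_simp
  have a2 : (-1 / 2 / ((τ : ℂ) / 2)) = -1 / τ := by field_simp
  have a3 : (-Real.pi * I * (-1 / 2) ^ 2 / ((τ : ℂ) / 2)) = Real.pi * I * (-1 / τ) / 2 := by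
    field_simp
  have a4 : cexp (2 * Real.pi * I * (-1 / 2) + Real.pi * I * τ / 2)
      = - cexp (Real.pi * I * τ / 2) := by
    have : (2 * Real.pi * I * (-1 / 2) + Real.pi * I * τ / 2 : ℂ)
      = Real.pi * I * τ / 2 - Real.pi * I := by ring
    rw [this, Complex.exp_sub, exp_pi_mul_I, div_neg, div_one]
  have a5 : jacobiTheta₂ (2 * (-1 / 2) + τ) (2 * τ) = jacobiTheta₂ τ (2 * τ) := by
    rw [← jacobiTheta₂_add_left]; congr 1; ring
  have a6 : jacobiTheta₂ (2 * (-1 / 2)) (2 * τ) = jacobiTheta₂ 0 (2 * τ) := by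
    rw [← jacobiTheta₂_add_left]; congr 1; ring
  rw [a1, a2, a3, a4, a5, a6] at e1
  rw [a1] at e0
  simp only [mul_zero, zero_add, ne_eq, OfNat.ofNat_ne_zero, not_false_eq_true, zero_pow,
    zero_div, Complex.exp_zero, mul_one] at e0
  rw [one_div, mul_assoc (_⁻¹), eq_inv_mul_iff_mul_eq₀ hne, hs] at e1
  rw [one_div, eq_inv_mul_iff_mul_eq₀ hne, hs] at e0
  ext i
  fin_cases i
  · simp only [thetaVec, weilS, h]
    simp
    simp only [one_div] at e0
    simp only [neg_div, one_div] at e0 ⊢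
    rw [← e0]; ring
  · simp only [thetaVec, weilS, h]
    simp
    simp only [neg_div, one_div] at e1 ⊢
    rw [← e1]; ring

theorem Mp2Z.eq_or_neg (A B : Mp2Z) (h : A.mat = B.mat) :
    A.phi = B.phi ∨ A.phi = -B.phi := by
  have hA := A.holo.continuous
  have hB := B.holo.continuous
  have := isPreconnected_univ.eq_or_eq_neg_of_sq_eq (f := A.phi) (g := B.phi)
    hA.continuousOn hB.continuousOn
    (fun τ _ => by simp [A.sq_phi, B.sq_phi, h]) (fun {τ} _ => B.phi_ne_zero τ)
  simpa [Set.eqOn_univ] using this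

theorem Mp2Z.closure_S_T : Subgroup.closure {Mp2Z.S, Mp2Z.T} = ⊤ := by
  rw [eq_top_iff]
  intro A _
  have h1 : A.mat ∈ (Subgroup.closure {Mp2Z.S, Mp2Z.T}).map Mp2Z.toSL := by
    rw [MonoidHom.map_closure, Set.image_pair]
    have := _root_.SpecialLinearGroup.SL2Z_generators
    change A.mat ∈ Subgroup.closure {ModularGroup.S, ModularGroup.T}
    rw [this]; trivial
  obtain ⟨B, hB, hBA⟩ := h1
  change B.mat = A.mat at hBA
  rcases Mp2Z.eq_or_neg A B hBA.symm with h | h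
  · have : A = B := by ext1 <;> [exact hBA.symm; exact h]
    exact this ▸ hB
  · have hS : Mp2Z.S ∈ Subgroup.closure {Mp2Z.S, Mp2Z.T} := Subgroup.subset_closure (by simp)
    have hS2 : (ModularGroup.S * ModularGroup.S : SL(2, ℤ)) = -1 := by
      ext i j; fin_cases i <;> fin_cases j <;> rfl
    have hS4 : (Mp2Z.S * Mp2Z.S) * (Mp2Z.S * Mp2Z.S) * B = A := by
      have hm : (Mp2Z.S * Mp2Z.S).mat = -1 := hS2
      have hphi : ∀ τ, ((Mp2Z.S * Mp2Z.S) * (Mp2Z.S * Mp2Z.S)).phi τ = -1 := by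
        intro τ
        have h3 := (Mp2Z.S * Mp2Z.S).sq_phi τ
        rw [hm] at h3
        rw [Mp2Z.mul_phi (Mp2Z.S * Mp2Z.S), hm]
        have : (-1 : SL(2, ℤ)) • τ = τ := by
          rw [ModularGroup.SL_neg_smul, one_smul]
        rw [this, ← sq, h3]
        simp [j]
      ext1
      · rw [Mp2Z.mul_mat, Mp2Z.mul_mat, hm, hBA]; simp
      · funext τ
        rw [Mp2Z.mul_phi, hphi, h]; simp
    rw [← hS4]
    exact mul_mem (mul_mem (mul_mem hS hS) (mul_mem hS hS)) hB

theorem thetaVec_zero_ne : ∃ τ : ℍ, thetaVec τ 0 ≠ 0 := by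
  let τ : ℍ := ⟨I, by simp⟩
  refine ⟨τ, ?_⟩
  intro h0
  have h1 : jacobiTheta (2 * I) = 0 := by
    rw [jacobiTheta_eq_jacobiTheta₂]; simpa [thetaVec, τ] using h0
  have h2 := norm_jacobiTheta_sub_one_le (τ := 2 * I) (by simp)
  rw [h1] at h2
  simp only [zero_sub, norm_neg, norm_one] at h2
  have h3 : (2 * I : ℂ).im = 2 := by simp
  rw [h3] at h2
  have h4 : Real.exp (-Real.pi * 2) < 1 / 4 := by
    have : Real.exp (-Real.pi * 2) ≤ Real.exp (-2) :=
      Real.exp_le_exp.mpr (by nlinarith [Real.pi_gt_three])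
    have h5 : Real.exp (-2) = (Real.exp 1)⁻¹ * (Real.exp 1)⁻¹ := by
      rw [← Real.exp_neg, ← Real.exp_add]; norm_num
    have h6 : (Real.exp 1)⁻¹ < 2⁻¹ :=
      inv_strictAnti₀ (by norm_num) (by linarith [Real.exp_one_gt_d9])
    have h7 : 0 < (Real.exp 1)⁻¹ := by positivity
    nlinarith
  have h8 := Real.exp_pos (-Real.pi * 2)
  rw [div_mul_eq_mul_div, le_div_iff₀ (by linarith)] at h2
  linarith

theorem thetaVec_one_ne : ∃ τ : ℍ, thetaVec τ 1 ≠ 0 := by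
  by_contra! h
  obtain ⟨τ, hτ⟩ := thetaVec_zero_ne
  have h1 := congrFun (thetaVec_S τ) 1
  rw [h] at h1
  simp [weilS, dotProduct, Fin.sum_univ_two, h τ] at h1
  rcases h1 with h1 | h1 | h1
  · exact absurd h1 (by simp [τ.ne_zero])
  · have := congrArg Complex.im h1
    simp at this
  · exact hτ h1

theorem thetaVec_indep (v : Fin 2 → ℂ) (h : ∀ τ, v ⬝ᵥ thetaVec τ = 0) : v = 0 := by
  have h1 : ∀ τ, v 0 * thetaVec τ 0 + v 1 * thetaVec τ 1 = 0 := fun τ => by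
    simpa [dotProduct, Fin.sum_univ_two] using h τ
  have h2 : ∀ τ, v 0 * thetaVec τ 0 + v 1 * (I * thetaVec τ 1) = 0 := fun τ => by
    have := h1 (ModularGroup.T • τ)
    rw [thetaVec_T] at this
    simpa [weilT, Matrix.mulVec, dotProduct, Fin.sum_univ_two] using this
  have hI : (1 : ℂ) - I ≠ 0 := by
    intro h; have := congrArg Complex.im h; simp at this
  have h3 : ∀ τ, v 1 * thetaVec τ 1 = 0 := fun τ => by
    have : (1 - I) * (v 1 * thetaVec τ 1) = 0 := by linear_combination h1 τ - h2 τ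
    exact (mul_eq_zero.mp this).resolve_left hI
  obtain ⟨τ₀, h0⟩ := thetaVec_zero_ne
  obtain ⟨τ₁, h10⟩ := thetaVec_one_ne
  have hv1 : v 1 = 0 := (mul_eq_zero.mp (h3 τ₁)).resolve_right h10
  have hv0 : v 0 = 0 := by
    have := h1 τ₀
    rw [hv1, zero_mul, add_zero] at this
    exact (mul_eq_zero.mp this).resolve_right h0
  ext i; fin_cases i <;> [exact hv0; exact hv1]

theorem thetaVec_mat_ext (M M' : Matrix (Fin 2) (Fin 2) ℂ)
    (h : ∀ τ, M *ᵥ thetaVec τ = M' *ᵥ thetaVec τ) : M = M' := by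
  rw [← sub_eq_zero]
  funext i
  refine thetaVec_indep ((M - M') i) fun τ => ?_
  have := congrFun (h τ) i
  rw [← sub_eq_zero, ← Pi.sub_apply, ← Matrix.sub_mulVec] at this
  exact this

theorem det_weilT : weilT.det ≠ 0 := by simp [weilT]

theorem det_weilS : weilS.det ≠ 0 := by
  have h1 : (1 : ℂ) - I ≠ 0 := by
    intro h; have := congrArg Complex.im h; simp at this
  have h2 : weilS.det = ((1 - I) / 2) ^ 2 * (-2) := by
    simp [weilS, Matrix.det_fin_two]; ring
  rw [h2]
  exact mul_ne_zero (pow_ne_zero _ (div_ne_zero h1 two_ne_zero)) (by norm_num)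

theorem exists_theta_mat (A : Mp2Z) : ∃ M : GL (Fin 2) ℂ, ∀ τ,
    thetaVec (A.mat • τ) = A.phi τ • ((M : Matrix (Fin 2) (Fin 2) ℂ) *ᵥ thetaVec τ) := by
  have hA : A ∈ Subgroup.closure {Mp2Z.S, Mp2Z.T} := by rw [Mp2Z.closure_S_T]; trivial
  induction hA using Subgroup.closure_induction with
  | mem x hx =>
    rcases hx with rfl | rfl
    · exact ⟨Matrix.GeneralLinearGroup.mkOfDetNeZero weilS det_weilS, fun τ => thetaVec_S τ⟩
    · refine ⟨Matrix.GeneralLinearGroup.mkOfDetNeZero weilT det_weilT, fun τ => ?_⟩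
      exact (thetaVec_T τ).trans (one_smul ℂ _).symm
  | one => exact ⟨1, fun τ => by simp only [Mp2Z.one_mat, Mp2Z.one_phi, one_smul]; simp⟩
  | mul x y _ _ hx hy =>
    obtain ⟨M, hM⟩ := hx
    obtain ⟨M', hM'⟩ := hy
    refine ⟨M * M', fun τ => ?_⟩
    rw [Mp2Z.mul_mat, Mp2Z.mul_phi, mul_smul, hM, hM', Matrix.mulVec_smul, smul_smul,
      Matrix.mulVec_mulVec, Units.val_mul]
  | inv x _ hx =>
    obtain ⟨M, hM⟩ := hx
    refine ⟨M⁻¹, fun τ => ?_⟩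
    have h := hM (x.mat⁻¹ • τ)
    rw [smul_inv_smul] at h
    rw [Mp2Z.inv_mat, Mp2Z.inv_phi, h, Matrix.mulVec_smul, smul_smul,
      inv_mul_cancel₀ (x.phi_ne_zero _), one_smul, Matrix.mulVec_mulVec, ← Units.val_mul,
      inv_mul_cancel, Units.val_one, Matrix.one_mulVec]

theorem theta_mat_unique (A : Mp2Z) (M M' : GL (Fin 2) ℂ)
    (h : ∀ τ, thetaVec (A.mat • τ) = A.phi τ • ((M : Matrix (Fin 2) (Fin 2) ℂ) *ᵥ thetaVec τ))
    (h' : ∀ τ, thetaVec (A.mat • τ) =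
      A.phi τ • ((M' : Matrix (Fin 2) (Fin 2) ℂ) *ᵥ thetaVec τ)) : M = M' := by
  apply Units.ext
  refine thetaVec_mat_ext _ _ fun τ => ?_
  exact smul_right_injective _ (A.phi_ne_zero τ) ((h τ).symm.trans (h' τ))

/-- There is exactly one representation of `Mp₂(ℤ)` on `ℂ²` that takes the given values on the
generators `T` and `S`. -/
theorem existsUnique_weil : ∃! ρ : Mp2Z →* GL (Fin 2) ℂ,
    (ρ Mp2Z.T : Matrix (Fin 2) (Fin 2) ℂ) = !![1, 0; 0, I] ∧
    (ρ Mp2Z.S : Matrix (Fin 2) (Fin 2) ℂ) = ((1 - I) / 2) • !![1, 1; 1, -1] := by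
  choose M hM using exists_theta_mat
  let ρ : Mp2Z →* GL (Fin 2) ℂ := MonoidHom.mk' M fun A B => by
    refine theta_mat_unique (A * B) _ _ (hM _) fun τ => ?_
    rw [Mp2Z.mul_mat, Mp2Z.mul_phi, mul_smul, hM, hM, Matrix.mulVec_smul, smul_smul,
      Matrix.mulVec_mulVec, Units.val_mul]
  have hT : ρ Mp2Z.T = Matrix.GeneralLinearGroup.mkOfDetNeZero weilT det_weilT :=
    theta_mat_unique Mp2Z.T _ _ (hM _) fun τ => (thetaVec_T τ).trans (one_smul ℂ _).symm
  have hS : ρ Mp2Z.S = Matrix.GeneralLinearGroup.mkOfDetNeZero weilS det_weilS :=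
    theta_mat_unique Mp2Z.S _ _ (hM _) fun τ => thetaVec_S τ
  refine ⟨ρ, ⟨by rw [hT]; rfl, by rw [hS]; rfl⟩, fun ρ' ⟨h1, h2⟩ => ?_⟩
  refine MonoidHom.eq_of_eqOn_dense Mp2Z.closure_S_T ?_
  rintro x (rfl | rfl)
  · rw [hS]; exact Units.ext h2
  · rw [hT]; exact Units.ext h1

/-- The Weil representation `ρ₁` of `Mp₂(ℤ)` attached to the lattice of rank one generated by a
vector of norm `2`, in the canonical basis `𝔢₀, 𝔢₁`: the representation determined by
`ρ₁(T) = diag(1, i)` and `ρ₁(S) = (1 - i)/2 • (1 1; 1 -1)`. -/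
def weilRep : Mp2Z →* GL (Fin 2) ℂ := existsUnique_weil.choose

theorem weilRep_T : (weilRep Mp2Z.T : Matrix (Fin 2) (Fin 2) ℂ) = !![1, 0; 0, I] :=
  existsUnique_weil.choose_spec.1.1

theorem weilRep_S :
    (weilRep Mp2Z.S : Matrix (Fin 2) (Fin 2) ℂ) = ((1 - I) / 2) • !![1, 1; 1, -1] :=
  existsUnique_weil.choose_spec.1.2

/-- `ρ_ε`: the Weil representation `ρ₁` for `ε = 1`, and its complex conjugate `ρ₁*`, in the
canonical basis `𝔢₀, 𝔢₋₁`, for `ε = -1`. -/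
def weilRepSign (ε : ℤˣ) : Mp2Z →* GL (Fin 2) ℂ :=
  if ε = 1 then weilRep else (Matrix.GeneralLinearGroup.map (starRingEnd ℂ)).comp weilRep

/-! ### Congruence subgroups -/

/-- The inverse image of `Γ₀(N)` in `Mp₂(ℤ)`. -/
def Gamma0t (N : ℕ) : Subgroup Mp2Z := (CongruenceSubgroup.Gamma0 N).comap Mp2Z.toSL

/-- The inverse image of `Γ₁(N)` in `Mp₂(ℤ)`. -/
def Gamma1t (N : ℕ) : Subgroup Mp2Z := (CongruenceSubgroup.Gamma1 N).comap Mp2Z.toSL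

/-- The inverse image of `Γ_N = Γ₀(4N) ∩ Γ₁(N)` in `Mp₂(ℤ)`. -/
def GammaNt (N : ℕ) : Subgroup Mp2Z := Gamma0t (4 * N) ⊓ Gamma1t N

/-! ### The character `ψ` of the inverse image of `Γ₀(4)` -/

/-- The quadratic residue symbol `(c/d)` for odd `d`, extended to negative `d` in the way that suits
theta functions: `(c/d) = (c/|d|)`, with an additional sign if both `c` and `d` are negative, and
`(0/±1) = 1`. -/
def quadSymbol (c d : ℤ) : ℤ :=
  if c < 0 ∧ d < 0 then -jacobiSym c d.natAbs else jacobiSym c d.natAbs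

/-- `ε_d`, which is `1` for `d ≡ 1 (mod 4)` and `i` for `d ≡ 3 (mod 4)`. -/
def epsSymbol (d : ℤ) : ℂ := if d % 4 = 1 then 1 else I

open Classical in
/-- `ψ(α, ±√(j(α, τ))) = ± (c/d) conj(ε_d)`, where `√` is the principal branch; it is used only on
the inverse image of `Γ₀(4)`. -/
def psi (A : Mp2Z) : ℂ :=
  (if ∀ τ, A.phi τ = j A.mat τ ^ (1 / 2 : ℂ) then 1 else -1) *
    (quadSymbol (A.mat 1 0) (A.mat 1 1) : ℂ) * conj (epsSymbol (A.mat 1 1))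

/-! ### Automorphic forms -/

section Forms

variable {V : Type*} [NormedAddCommGroup V] [NormedSpace ℂ V]

/-- The real-analytic functions `f : ℍ → V` with `f(ατ) = φ(τ)^m ρ(A) f(τ)` for all `A = (α, φ)`
in `Γ`. Since `ρ(A)` is invertible, the equation says that `f` is invariant under the slash operator
`(f | A)(τ) = φ(τ)^(-m) ρ(A)⁻¹ f(ατ)`. Here `m` is twice the weight. -/
def autForms (m : ℤ) (Γ : Subgroup Mp2Z) (ρ : Mp2Z → V →ₗ[ℂ] V) : Submodule ℂ (ℍ → V) where
  carrier := {f | AnalyticOnNhd ℝ (fun z : ℂ => f (ofComplex z)) {z | 0 < z.im} ∧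
    ∀ A ∈ Γ, ∀ τ : ℍ, f (A.mat • τ) = A.phi τ ^ m • ρ A (f τ)}
  zero_mem' := ⟨analyticOnNhd_const, fun A _ τ => by simp⟩
  add_mem' := fun {f g} hf hg =>
    ⟨hf.1.add hg.1, fun A hA τ => by
      rw [Pi.add_apply, Pi.add_apply, hf.2 A hA τ, hg.2 A hA τ, map_add, smul_add]⟩
  smul_mem' := fun c f hf =>
    ⟨fun z hz => by
      have h1 : AnalyticAt ℝ (fun _ : ℂ => c) z := analyticAt_const
      exact h1.smul (hf.1 z hz),
      fun A hA τ => by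
        rw [Pi.smul_apply, Pi.smul_apply, hf.2 A hA τ, map_smul, smul_comm c]⟩

end Forms

/-- The one-dimensional representation given by a scalar multiplier. -/
def scalarRep (v : Mp2Z → ℂ) (A : Mp2Z) : ℂ →ₗ[ℂ] ℂ := v A • LinearMap.id

/-- The representation `ρ_ε` on `ℂ²`. -/
def vectorRep (ε : ℤˣ) (A : Mp2Z) : (Fin 2 → ℂ) →ₗ[ℂ] (Fin 2 → ℂ) :=
  Matrix.mulVecLin (weilRepSign ε A : Matrix (Fin 2) (Fin 2) ℂ)

/-- The value of a Dirichlet character on an element of `Mp₂(ℤ)`, through the lower right entry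
of the matrix. -/
def charVal {N : ℕ} (χ : DirichletCharacter ℂ N) (A : Mp2Z) : ℂ := χ ((A.mat 1 1 : ℤ) : ZMod N)

open Classical in
/-- The character `ω_χ(d) = (4χ(-1)/d) χ(d)` modulo `4N`: the symbol `(4/d)` is the trivial
character modulo `4`, and `(-4/d)` is the non-trivial one. -/
def omegaChar {N : ℕ} (χ : DirichletCharacter ℂ N) : DirichletCharacter ℂ (4 * N) :=
  (if χ (-1) = 1 then 1 else
    DirichletCharacter.changeLevel (dvd_mul_right 4 N)
      (ZMod.χ₄.ringHomComp (Int.castRingHom ℂ) : DirichletCharacter ℂ 4)) *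
  DirichletCharacter.changeLevel (dvd_mul_left N 4) χ

/-! ### Fourier expansions, the plus-space and the lift -/

/-- The function `c_n(y)` in the expansion `f(τ) = ∑ c_n(y) q^n`, `τ = x + i y`. -/
def fourierC (f : ℍ → ℂ) (n : ℤ) (y : ℝ) : ℂ :=
  ∫ x in (0 : ℝ)..1,
    f (ofComplex (x + y * I)) * cexp (-(2 * Real.pi * I * n * (x + y * I)))

/-- The term of index `n` of the series `f_r`: it is `c_n(y/4) q^{n/4}` if `n ≡ r (mod 4)`, and `0`
otherwise. -/
def fourierPartTerm (f : ℍ → ℂ) (r : ZMod 4) (τ : ℍ) (n : ℤ) : ℂ :=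
  if (n : ZMod 4) = r then
    fourierC f n (τ.im / 4) * cexp (2 * Real.pi * I * n * τ / 4) else 0

/-- `f_r(τ) = ∑_{n ≡ r (mod 4)} c_n(y/4) q^{n/4}`. -/
def fourierPart (f : ℍ → ℂ) (r : ZMod 4) (τ : ℍ) : ℂ := ∑' n : ℤ, fourierPartTerm f r τ n

theorem fourierC_intervalIntegrable {f : ℍ → ℂ}
    (hf : AnalyticOnNhd ℝ (fun z : ℂ => f (ofComplex z)) {z | 0 < z.im}) (n : ℤ) {y : ℝ}
    (hy : 0 < y) : IntervalIntegrable (fun x : ℝ => f (ofComplex (x + y * I)) *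
      cexp (-(2 * Real.pi * I * n * (x + y * I)))) MeasureTheory.volume 0 1 := by
  refine Continuous.intervalIntegrable (Continuous.mul ?_ (by fun_prop)) 0 1
  exact hf.continuousOn.comp_continuous (f := fun x : ℝ => (x + y * I : ℂ)) (by fun_prop)
    fun x => by simpa using hy

theorem fourierC_add {f g : ℍ → ℂ}
    (hf : AnalyticOnNhd ℝ (fun z : ℂ => f (ofComplex z)) {z | 0 < z.im})
    (hg : AnalyticOnNhd ℝ (fun z : ℂ => g (ofComplex z)) {z | 0 < z.im}) (n : ℤ) {y : ℝ}
    (hy : 0 < y) : fourierC (f + g) n y = fourierC f n y + fourierC g n y := by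
  rw [fourierC, fourierC, fourierC, ← intervalIntegral.integral_add
    (fourierC_intervalIntegrable hf n hy) (fourierC_intervalIntegrable hg n hy)]
  simp only [Pi.add_apply, add_mul]

theorem fourierC_smul (c : ℂ) (f : ℍ → ℂ) (n : ℤ) (y : ℝ) :
    fourierC (c • f) n y = c * fourierC f n y := by
  rw [fourierC, fourierC, ← intervalIntegral.integral_const_mul]
  simp only [Pi.smul_apply, smul_eq_mul, mul_assoc]

/-- The plus-space in the space of automorphic forms of weight `k + 1/2` and character
`ψ^(2k+ξ)` for the group `Γ̃_N`. -/
def plusSpace (N k : ℕ) (ξ : ℤˣ) : Submodule ℂ (ℍ → ℂ) where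
  carrier := {f | f ∈ autForms (2 * k + 1) (GammaNt N)
      (scalarRep fun A => psi A ^ (2 * (k : ℤ) + (ξ : ℤ))) ∧
    ∀ n : ℤ, ¬ ((((-1) ^ k * (ξ : ℤ) * n : ℤ) : ZMod 4) = 0 ∨
      (((-1) ^ k * (ξ : ℤ) * n : ℤ) : ZMod 4) = 1) → ∀ y : ℝ, 0 < y → fourierC f n y = 0}
  zero_mem' := ⟨zero_mem _, fun n _ y _ => by simp [fourierC]⟩
  add_mem' := fun {f g} hf hg => ⟨add_mem hf.1 hg.1, fun n hn y hy => by
    rw [fourierC_add hf.1.1 hg.1.1 n hy, hf.2 n hn y hy, hg.2 n hn y hy, add_zero]⟩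
  smul_mem' := fun c f hf => ⟨Submodule.smul_mem _ c hf.1, fun n hn y hy => by
    rw [fourierC_smul, hf.2 n hn y hy, mul_zero]⟩

/-- The plus-space of automorphic forms of weight `k + 1/2` and character `ψ^(2k+1) ω_χ` for the
inverse image of `Γ₀(4N)`. -/
def plusSpaceChar (N k : ℕ) (ξ : ℤˣ) (χ : DirichletCharacter ℂ N) : Submodule ℂ (ℍ → ℂ) :=
  autForms (2 * k + 1) (Gamma0t (4 * N))
    (scalarRep fun A => psi A ^ (2 * (k : ℤ) + 1) * charVal (omegaChar χ) A) ⊓ plusSpace N k ξ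

/-- The lift `L_ε f = f₀ 𝔢₀ + f_ε 𝔢_ε`. -/
def lift (ε : ℤˣ) (f : ℍ → ℂ) (τ : ℍ) : Fin 2 → ℂ :=
  ![fourierPart f 0 τ, fourierPart f ((ε : ℤ) : ZMod 4) τ]

end HalfIntegral
end

noncomputable section

namespace HalfIntegral

open Complex Matrix
open UpperHalfPlane hiding I
open scoped MatrixGroups ComplexConjugate

/-! ### The quadratic residue symbol -/

/-! The map `τ ↦ 4 τ` conjugates the preimage of `Γ₀(4N)` into the part of the preimage of `Γ₀(N)`
with upper right entry divisible by `4`; `IsFourConj A B` records this relation. The plus condition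
says exactly that `f(τ/4)` is the sum of the two entries of `L_ε f`. So the theorem compares a
vector `F` with the sum of its entries, and the inverse map is `F ↦ F₀(4τ) + F_ε(4τ)`.

From vector to sum: for conjugate `A`, `B` the row `(1, 1)` is a left eigenvector of `ρ_ε(B)` with
eigenvalue `ψ(A)^ε` (`IsFourConj.vectorRep_sum`). To see this, write `θ(τ) = ∑ q^{n²}` as the sum of
the entries of the theta vector at `4τ`. Under `A` the left side is multiplied by `ψ(A) φ`
(`thetaVec_zero_smul`), the right side transforms by `ρ₁(B)`, and the entries are linearly
independent.

From sum to vector (`transform_of_sum_transform`): let `D` be the failure of the transformation law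
of `F` under a given `A`. Multiplying `A` by powers of `T` on both sides gives matrices with upper
right entry divisible by `4`, and the law for the sum yields `D₀ + i^{εn} D₁ = 0` for all `n` of one
parity. Two such `n` that differ by `2` force `D = 0`.

The multipliers match because `ψ⁴ = 1` and `2k + ξ ≡ ε (mod 4)`, and because `ψ²` is the non-trivial
character modulo `4`. Convergence holds because the Fourier coefficients of a smooth periodic
function are `O(n⁻²)`. -/

theorem jacobiSym_four_mul (a : ℤ) {b : ℕ} (hb : Odd b) :
    jacobiSym (4 * a) b = jacobiSym a b := by
  rw [jacobiSym.mul_left, jacobiSym.at_four hb, one_mul]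

/-- Since `4a = b + c` and `4` is a square, the two symbols are `(c/b)` and `(b/c)`. One of `b`, `c`
is `1` modulo `4`, so reciprocity carries no sign. -/
theorem jacobiSym_eq_of_add_eq {a b c : ℕ} (hb : Odd b) (hc : Odd c) (h : b + c = 4 * a) :
    jacobiSym a b = jacobiSym a c := by
  have hb4 : jacobiSym a b = jacobiSym c b := by
    rw [← jacobiSym_four_mul _ hb]
    exact jacobiSym.mod_left' (by rw [show (4 * (a : ℤ)) = c + b by exact_mod_cast (by omega)]; simp)
  have hc4 : jacobiSym a c = jacobiSym b c := by
    rw [← jacobiSym_four_mul _ hc]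
    exact jacobiSym.mod_left' (by rw [show (4 * (a : ℤ)) = b + c by exact_mod_cast (by omega)]; simp)
  rw [hb4, hc4]
  have hb2 := Nat.odd_iff.mp hb
  rcases (by omega : b % 4 = 1 ∨ c % 4 = 1) with h1 | h1
  · exact (jacobiSym.quadratic_reciprocity_one_mod_four h1 hc).symm
  · exact jacobiSym.quadratic_reciprocity_one_mod_four h1 hb

theorem jacobiSym_neg_of_add_eq {a b c : ℕ} (hb : Odd b) (hc : Odd c) (h : b + c = 4 * a) :
    jacobiSym (-a) b = -jacobiSym (-a) c := by
  rw [jacobiSym.neg _ hb, jacobiSym.neg _ hc, jacobiSym_eq_of_add_eq hb hc h]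
  have hb2 := Nat.odd_iff.mp hb
  rcases (by omega : b % 4 = 1 ∧ c % 4 = 3 ∨ b % 4 = 3 ∧ c % 4 = 1) with ⟨h1, h2⟩ | ⟨h1, h2⟩
  · rw [ZMod.χ₄_nat_one_mod_four h1, ZMod.χ₄_nat_three_mod_four h2]; ring
  · rw [ZMod.χ₄_nat_three_mod_four h1, ZMod.χ₄_nat_one_mod_four h2]; ring

theorem jacobiSym_four_mul_congr (a : ℤ) {b c : ℕ} (hb : Odd b) (hc : Odd c)
    (h : ((4 * a.natAbs : ℕ) : ℤ) ∣ (c : ℤ) - b) : jacobiSym (4 * a) b = jacobiSym (4 * a) c := by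
  have h' : b % (4 * a.natAbs) = c % (4 * a.natAbs) := (Nat.modEq_iff_dvd.mpr h)
  rw [jacobiSym_four_mul _ hb, jacobiSym_four_mul _ hc, jacobiSym.mod_right _ hb,
    jacobiSym.mod_right _ hc, h']

/-- If `d` and `d + c` have the same sign, this is the periodicity of `(4a/·)` modulo `4|a|`. If the
signs differ, then `|d| + |d + c| = |c|` and the reflection lemmas above apply; for `c < 0` their
sign is the one built into `quadSymbol`. -/
theorem quadSymbol_add_right {c d : ℤ} (hc : 4 ∣ c) (hd : Odd d) :
    quadSymbol c (d + c) = quadSymbol c d := by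
  obtain ⟨a, rfl⟩ := hc
  have hdc : Odd (d + 4 * a) := hd.add_even (by rw [Int.even_iff]; omega)
  have h1 := Int.natAbs_odd.mpr hd
  have h2 := Int.natAbs_odd.mpr hdc
  have hd2 := Int.odd_iff.mp hd
  unfold quadSymbol
  rcases lt_or_gt_of_ne (show d ≠ 0 by omega) with hd0 | hd0 <;>
    rcases lt_or_gt_of_ne (show d + 4 * a ≠ 0 by omega) with hs | hs
  · rw [jacobiSym_four_mul_congr a h2 h1]
    · simp [hd0, hs]
    · rcases abs_cases a with h | h
      · exact ⟨1, by omega⟩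
      · exact ⟨-1, by omega⟩
  · obtain ⟨n, rfl⟩ : ∃ n : ℕ, a = n := ⟨a.natAbs, by omega⟩
    rw [if_neg (by omega), if_neg (by omega), jacobiSym_four_mul _ h1, jacobiSym_four_mul _ h2,
      jacobiSym_eq_of_add_eq h2 h1 (by omega)]
  · obtain ⟨n, rfl⟩ : ∃ n : ℕ, a = -n := ⟨a.natAbs, by omega⟩
    rw [if_pos (by omega), if_neg (by omega), jacobiSym_four_mul _ h1, jacobiSym_four_mul _ h2,
      jacobiSym_neg_of_add_eq h2 h1 (by omega), neg_neg]
  · rw [jacobiSym_four_mul_congr a h2 h1]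
    · simp [not_lt.mpr hd0.le, not_lt.mpr hs.le]
    · rcases abs_cases a with h | h
      · exact ⟨-1, by omega⟩
      · exact ⟨1, by omega⟩

/-- The exceptional sign appears exactly when `c` turns negative while `d < 0`. It cancels the sign
of the square roots in `sqrt_mul_sqrt_lower`. -/
theorem quadSymbol_add_four_mul_left (c d : ℤ) :
    quadSymbol (c + 4 * d) d =
      if d < 0 ∧ 0 ≤ c ∧ c + 4 * d < 0 then -quadSymbol c d else quadSymbol c d := by
  have h : jacobiSym (c + 4 * d) d.natAbs = jacobiSym c d.natAbs :=
    jacobiSym.mod_left' ((Int.modEq_iff_dvd.mpr (by simp [dvd_mul_left])).symm)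
  unfold quadSymbol
  rw [h]
  split_ifs <;> first | rfl | (exfalso; omega)

/-! ### The principal branch of the square root -/

theorem sqrt_sq (z : ℂ) : (z ^ (1 / 2 : ℂ)) ^ 2 = z := by
  rw [← cpow_nat_mul]; simp

theorem sqrt_eq_of_re_pos {z w : ℂ} (h : w ^ 2 = z) (hw : 0 < w.re) : z ^ (1 / 2 : ℂ) = w := by
  rw [← h]; simpa using Complex.sq_cpow_two_inv hw

theorem sqrt_neg_one : (-1 : ℂ) ^ (1 / 2 : ℂ) = I := by
  rw [cpow_def_of_ne_zero (by norm_num), log_neg_one,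
    show (Real.pi * I * (1 / 2) : ℂ) = Real.pi / 2 * I by ring, exp_pi_div_two_mul_I]

theorem sqrt_re_pos {z : ℂ} (hz : z.im ≠ 0) : 0 < (z ^ (1 / 2 : ℂ)).re := by
  have hz0 : z ≠ 0 := fun h => hz (by simp [h])
  have h1 : z.arg ≠ Real.pi := fun h => hz (arg_eq_pi_iff.mp h).2
  rw [cpow_def_of_ne_zero hz0, exp_re]
  refine mul_pos (Real.exp_pos _) (Real.cos_pos_of_mem_Ioo ?_)
  simp [log_im]
  constructor <;> linarith [neg_pi_lt_arg z, lt_of_le_of_ne (arg_le_pi z) h1]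

theorem two_mul_re_mul_im_eq (w : ℂ) : 2 * (w.re * w.im) = (w ^ 2).im := by
  rw [sq, mul_im]; ring

theorem sqrt_im_pos {z : ℂ} (hz : 0 < z.im) : 0 < (z ^ (1 / 2 : ℂ)).im := by
  have h := two_mul_re_mul_im_eq (z ^ (1 / 2 : ℂ))
  rw [sqrt_sq] at h
  exact pos_of_mul_pos_right (by linarith) (sqrt_re_pos hz.ne').le

theorem sqrt_im_neg {z : ℂ} (hz : z.im < 0) : (z ^ (1 / 2 : ℂ)).im < 0 := by
  have h := two_mul_re_mul_im_eq (z ^ (1 / 2 : ℂ))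
  rw [sqrt_sq] at h
  exact neg_of_mul_neg_right (by linarith) (sqrt_re_pos hz.ne).le

/-- The cocycle of the principal square roots of `z = (c + 4 d) τ + d` and `w = 4 τ + 1`. -/
theorem sqrt_mul_sqrt_lower (c d : ℤ) (hcd : c + 4 * d = 0 → d = 1 ∨ d = -1)
    (hc0 : c = 0 → d = 1 ∨ d = -1) (τ : ℍ)
    (z : ℂ) (hz : z * (4 * τ + 1) = (c + 4 * d) * τ + d) :
    z ^ (1 / 2 : ℂ) * (4 * (τ : ℂ) + 1) ^ (1 / 2 : ℂ) =
      (if d < 0 ∧ 0 ≤ c ∧ c + 4 * d < 0 then -1 else 1) *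
        (((c : ℂ) + 4 * d) * τ + d) ^ (1 / 2 : ℂ) := by
  have hτ : 0 < (τ : ℂ).im := τ.im_pos
  have hw : 0 < (4 * (τ : ℂ) + 1).im := by simpa using hτ
  have hp := sqrt_re_pos hw.ne'
  have hq := sqrt_im_pos hw
  set s := (4 * (τ : ℂ) + 1) ^ (1 / 2 : ℂ) with hs
  set r := z ^ (1 / 2 : ℂ) with hr
  have hsq : (r * s) ^ 2 = ((c : ℂ) + 4 * d) * τ + d := by
    rw [mul_pow, hs, hr, sqrt_sq, sqrt_sq, hz]
  have him := two_mul_re_mul_im_eq (r * s)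
  rw [hsq] at him
  have him' : ((((c : ℂ) + 4 * d) * τ + d)).im = (c + 4 * d : ℤ) * (τ : ℂ).im := by
    have : (((c : ℂ) + 4 * d)) = ((c + 4 * d : ℤ) : ℂ) := by push_cast; rfl
    rw [this, add_im, mul_im]; simp
  rw [him'] at him
  -- The sign of `Im z` is the sign of `c`, which decides the quadrant of `r`; `s` always lies in
  -- the first quadrant.
  have hzim : z.im * normSq (4 * (τ : ℂ) + 1) = c * (τ : ℂ).im := by
    have h1 : z * normSq (4 * (τ : ℂ) + 1) = (((c : ℂ) + 4 * d) * τ + d) * conj (4 * (τ : ℂ) + 1) := by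
      rw [← hz, mul_assoc, mul_conj]
    have h2 := congrArg Complex.im h1
    rw [im_mul_ofReal] at h2
    rw [h2]; simp; ring
  have hn : 0 < normSq (4 * (τ : ℂ) + 1) := normSq_pos.mpr fun h => by simp [h] at hw
  rcases lt_trichotomy c 0 with hc | rfl | hc
  -- Here `r` is in the fourth quadrant and `s` in the first, so `r s` has positive real part and is
  -- the principal root.
  · have hc' : (c : ℝ) < 0 := by exact_mod_cast hc
    have hz' : z.im < 0 := neg_of_mul_neg_left (by rw [hzim]; nlinarith) hn.le
    have hr1 := sqrt_re_pos hz'.ne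
    have hr2 := sqrt_im_neg hz'
    rw [if_neg (by omega), one_mul, sqrt_eq_of_re_pos hsq]
    rw [mul_re]
    nlinarith
  · rcases hc0 rfl with rfl | rfl
    · have hz1 : z = 1 := by
        have h0 : (4 * (τ : ℂ) + 1) ≠ 0 := fun h => by simp [h] at hw
        refine mul_right_cancel₀ h0 ?_
        rw [hz]; push_cast; ring
      rw [if_neg (by omega), hr, hz1, one_cpow, hs]
      simp
    · have hz1 : z = -1 := by
        have h0 : (4 * (τ : ℂ) + 1) ≠ 0 := fun h => by simp [h] at hw
        refine mul_right_cancel₀ h0 ?_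
        rw [hz]; push_cast; ring
      rw [hz1, sqrt_neg_one] at hr
      have h2 : 0 < (-(r * s)).re := by rw [hr]; simpa using hq
      rw [if_pos (by omega), ← neg_sq] at *
      rw [sqrt_eq_of_re_pos hsq h2]; ring
  · have hc' : (0 : ℝ) < c := by exact_mod_cast hc
    have hz' : 0 < z.im := pos_of_mul_pos_left (by rw [hzim]; positivity) hn.le
    have hr1 := sqrt_re_pos hz'.ne'
    have hr2 := sqrt_im_pos hz'
    -- Both roots are in the first quadrant, so `Im (r s) > 0`, and the sign of `Re (r s)` is that
    -- of `Im (r s)²`, hence that of `c + 4 d`.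
    have hi : 0 < (r * s).im := by rw [mul_im]; positivity
    rcases lt_trichotomy (c + 4 * d) 0 with h | h | h
    · have h' : ((c + 4 * d : ℤ) : ℝ) < 0 := by exact_mod_cast h
      have h2 : (r * s).re < 0 := neg_of_mul_neg_left (by nlinarith) hi.le
      rw [if_pos (by omega), sqrt_eq_of_re_pos (w := -(r * s)) (by rw [neg_sq, hsq]) (by simpa using h2)]
      ring
    · have hd : d = -1 := by rcases hcd h with h1 | h1 <;> omega
      rw [if_neg (by omega), one_mul]
      have h1 : ((c : ℂ) + 4 * d) = 0 := by exact_mod_cast h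
      rw [h1, hd] at hsq ⊢
      have h3 : (r * s) ^ 2 = I ^ 2 := by rw [hsq, I_sq]; push_cast; ring
      rcases sq_eq_sq_iff_eq_or_eq_neg.mp h3 with h4 | h4
      · rw [h4]; push_cast; rw [zero_mul, zero_add, sqrt_neg_one]
      · rw [h4] at hi; simp at hi; linarith
    · have h' : (0 : ℝ) < ((c + 4 * d : ℤ) : ℝ) := by exact_mod_cast h
      have h2 : 0 < (r * s).re := pos_of_mul_pos_left (by nlinarith) hi.le
      rw [if_neg (by omega), one_mul, sqrt_eq_of_re_pos hsq h2]

/-! ### The theta multiplier -/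

theorem det_eq_one (α : SL(2, ℤ)) : α 0 0 * α 1 1 - α 0 1 * α 1 0 = 1 := by
  rw [← Matrix.det_fin_two, α.det_coe]

theorem sl_mul_apply (α β : SL(2, ℤ)) (i k : Fin 2) :
    (α * β) i k = α i 0 * β 0 k + α i 1 * β 1 k := by
  exact (congrFun₂ (Matrix.SpecialLinearGroup.coe_mul α β) i k).trans
    (Matrix.mul_apply.trans (Fin.sum_univ_two _))

/-- The pair `(α, √(c τ + d))` with the principal branch of the square root. -/
def principalLift (α : SL(2, ℤ)) : Mp2Z where
  mat := α
  phi := fun τ => j α τ ^ (1 / 2 : ℂ)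
  holo := by
    -- For `c = 0` the factor is a constant, possibly negative and thus on the branch cut; for `c ≠
    -- 0` it is never real, so the power is differentiable.
    by_cases hc : α 1 0 = 0
    · have : (fun τ : ℍ => j α τ ^ (1 / 2 : ℂ)) = fun _ => ((α 1 1 : ℤ) : ℂ) ^ (1 / 2 : ℂ) := by
        funext τ; simp [j, hc]
      rw [this]
      exact mdifferentiable_const
    · rw [mdifferentiable_iff]
      refine DifferentiableOn.congr
        (f := fun z : ℂ => (((α 1 0 : ℤ) : ℂ) * z + ((α 1 1 : ℤ) : ℂ)) ^ (1 / 2 : ℂ)) ?_ ?_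
      · intro z hz
        refine (DifferentiableAt.cpow_const (by fun_prop) (Or.inr ?_)).differentiableWithinAt
        have hz' : z.im ≠ 0 := ne_of_gt hz
        simp [hc, hz']
      · intro z hz
        simp only [Function.comp_apply, j]
        rw [ofComplex_apply_of_im_pos hz]
  sq_phi := fun τ => sqrt_sq _

open Classical in
/-- The sign `±` of `(α, ±√(c τ + d))`. -/
def rootSign (A : Mp2Z) : ℂ := if ∀ τ, A.phi τ = j A.mat τ ^ (1 / 2 : ℂ) then 1 else -1

theorem psi_eq (A : Mp2Z) : psi A =
    rootSign A * (quadSymbol (A.mat 1 0) (A.mat 1 1) : ℂ) * conj (epsSymbol (A.mat 1 1)) := rfl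

theorem rootSign_mul_self (A : Mp2Z) : rootSign A * rootSign A = 1 := by
  unfold rootSign; split_ifs <;> norm_num

theorem phi_eq_rootSign_mul (A : Mp2Z) (τ : ℍ) :
    A.phi τ = rootSign A * j A.mat τ ^ (1 / 2 : ℂ) := by
  unfold rootSign
  split_ifs with h
  · rw [h, one_mul]
  · rcases Mp2Z.eq_or_neg A (principalLift A.mat) rfl with h1 | h1
    · exact absurd (fun τ => congrFun h1 τ) h
    · rw [h1]; simp [principalLift]

theorem sqrt_j_ne_zero (α : SL(2, ℤ)) (τ : ℍ) : j α τ ^ (1 / 2 : ℂ) ≠ 0 :=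
  (principalLift α).phi_ne_zero τ

/-- The sign is constant on the connected half-plane, so a single point determines it. -/
theorem rootSign_eq_of_phi {A : Mp2Z} {s : ℂ} (τ : ℍ)
    (h : A.phi τ = s * j A.mat τ ^ (1 / 2 : ℂ)) : rootSign A = s :=
  mul_right_cancel₀ (sqrt_j_ne_zero A.mat τ) ((phi_eq_rootSign_mul A τ).symm.trans h)

/-- The pair `((1 0; 4 1), √(4 τ + 1))`. -/
def lowerFour : Mp2Z := principalLift ⟨!![1, 0; 4, 1], by simp [Matrix.det_fin_two]⟩

theorem mul_T_lower (A : Mp2Z) : (A * Mp2Z.T).mat 1 0 = A.mat 1 0 ∧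
    (A * Mp2Z.T).mat 1 1 = A.mat 1 1 + A.mat 1 0 := by
  rw [Mp2Z.mul_mat, sl_mul_apply, sl_mul_apply]
  constructor <;> simp [Mp2Z.T, ModularGroup.T, add_comm]

theorem mul_lowerFour_lower (A : Mp2Z) :
    (A * lowerFour).mat 1 0 = A.mat 1 0 + 4 * A.mat 1 1 ∧
    (A * lowerFour).mat 1 1 = A.mat 1 1 := by
  rw [Mp2Z.mul_mat, sl_mul_apply, sl_mul_apply]
  constructor <;> simp [lowerFour, principalLift, mul_comm]

theorem lower_right_odd {A : Mp2Z} (h : 4 ∣ A.mat 1 0) : Odd (A.mat 1 1) := by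
  obtain ⟨c, hc⟩ := h
  have hd := det_eq_one A.mat
  rw [hc] at hd
  by_contra h0
  rw [Int.not_odd_iff_even] at h0
  obtain ⟨e, he⟩ := h0
  rw [he] at hd
  have : 2 * (A.mat 0 0 * e - A.mat 0 1 * (2 * c)) = 1 := by linear_combination hd
  omega

theorem epsSymbol_congr {d d' : ℤ} (h : d % 4 = d' % 4) : epsSymbol d = epsSymbol d' := by
  simp [epsSymbol, h]

theorem psi_mul_T {A : Mp2Z} (h : 4 ∣ A.mat 1 0) : psi (A * Mp2Z.T) = psi A := by
  obtain ⟨h1, h2⟩ := mul_T_lower A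
  have hs : rootSign (A * Mp2Z.T) = rootSign A := by
    refine rootSign_eq_of_phi UpperHalfPlane.I ?_
    have : (A * Mp2Z.T).phi UpperHalfPlane.I = A.phi (Mp2Z.T.mat • UpperHalfPlane.I) := by
      rw [Mp2Z.mul_phi]; simp [Mp2Z.T]
    rw [this, phi_eq_rootSign_mul, Mp2Z.mul_mat, j_mul]
    congr 2
    simp [Mp2Z.T, j, ModularGroup.T]
  rw [psi_eq, psi_eq, hs, h1, h2, quadSymbol_add_right h (lower_right_odd h),
    epsSymbol_congr (d := A.mat 1 1 + A.mat 1 0) (d' := A.mat 1 1) (by omega)]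

theorem lower_right_unit_of_lower_left_eq_zero {α : SL(2, ℤ)} (h : α 1 0 = 0) :
    α 1 1 = 1 ∨ α 1 1 = -1 := by
  have hd := det_eq_one α
  rw [h, mul_zero, sub_zero, mul_comm] at hd
  exact Int.isUnit_iff.mp (IsUnit.of_mul_eq_one _ hd)

/-- The sign of the product of principal roots and the sign in the quadratic symbol change under the
same condition on `c` and `d`, so they cancel. -/
theorem psi_mul_lowerFour {A : Mp2Z} : psi (A * lowerFour) = psi A := by
  obtain ⟨h1, h2⟩ := mul_lowerFour_lower A
  set c := A.mat 1 0 with hc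
  set d := A.mat 1 1 with hd
  have hs : rootSign (A * lowerFour) =
      rootSign A * (if d < 0 ∧ 0 ≤ c ∧ c + 4 * d < 0 then -1 else 1) := by
    let τ := UpperHalfPlane.I
    have hj : j lowerFour.mat τ = 4 * (τ : ℂ) + 1 := by simp [lowerFour, principalLift, j]
    have hj2 : j (A * lowerFour).mat τ = ((c : ℂ) + 4 * d) * τ + d := by
      rw [j, h1, h2]; push_cast; rfl
    refine rootSign_eq_of_phi τ ?_
    rw [Mp2Z.mul_phi, phi_eq_rootSign_mul A, hj2, mul_assoc, mul_assoc,
      ← sqrt_mul_sqrt_lower c d (fun h => ?_) (fun h => ?_) τ (j A.mat (lowerFour.mat • τ)) ?_, ← hj]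
    · rfl
    · rw [← hj, ← hj2, ← j_mul]; rfl
    · rw [← h2]
      exact lower_right_unit_of_lower_left_eq_zero (h1.trans h)
    · exact lower_right_unit_of_lower_left_eq_zero h
  rw [psi_eq, psi_eq, hs, h1, h2, quadSymbol_add_four_mul_left]
  split_ifs <;> push_cast <;> ring

/-- The transformation law of the theta vector under `ρ₁`. -/
theorem thetaVec_smul (A : Mp2Z) (τ : ℍ) : thetaVec (A.mat • τ) =
    A.phi τ • ((weilRep A : Matrix (Fin 2) (Fin 2) ℂ) *ᵥ thetaVec τ) := by
  -- `weilRep` is known only through its values on the generators, so the representation read off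
  -- from the theta vector is rebuilt and compared with it on `S` and `T`.
  choose M hM using exists_theta_mat
  let ρ : Mp2Z →* GL (Fin 2) ℂ := MonoidHom.mk' M fun A B => by
    refine theta_mat_unique (A * B) _ _ (hM _) fun τ => ?_
    rw [Mp2Z.mul_mat, Mp2Z.mul_phi, mul_smul, hM, hM, Matrix.mulVec_smul, smul_smul,
      Matrix.mulVec_mulVec, Units.val_mul]
  have hρ : ρ = weilRep := by
    refine MonoidHom.eq_of_eqOn_dense Mp2Z.closure_S_T ?_
    rintro x (rfl | rfl)
    · exact theta_mat_unique Mp2Z.S _ _ (hM _) fun τ => by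
        rw [weilRep_S]; exact thetaVec_S τ
    · exact theta_mat_unique Mp2Z.T _ _ (hM _) fun τ => by
        rw [weilRep_T]; exact (thetaVec_T τ).trans (one_smul ℂ _).symm
  rw [← hρ]; exact hM A τ

/-! ### The theta function under the preimage of `Γ₀(4)`. -/

theorem T_zpow_mat (n : ℤ) : (Mp2Z.T ^ n).mat = ModularGroup.T ^ n :=
  map_zpow Mp2Z.toSL Mp2Z.T n

theorem T_zpow_phi (n : ℤ) (τ : ℍ) : (Mp2Z.T ^ n).phi τ = 1 := by
  induction n generalizing τ with
  | zero => simp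
  | succ n ih => rw [_root_.zpow_add_one, Mp2Z.mul_phi, ih]; simp [Mp2Z.T]
  | pred n ih => rw [_root_.zpow_sub_one, Mp2Z.mul_phi, ih]; simp [Mp2Z.T]

theorem weilRep_T_pow_four : weilRep (Mp2Z.T ^ (4 : ℤ)) = 1 := by
  apply Units.ext
  rw [map_zpow, zpow_ofNat, Units.val_pow_eq_pow_val, weilRep_T]
  ext i k
  fin_cases i <;> fin_cases k <;> simp [pow_succ, Matrix.mul_apply, Fin.sum_univ_two]

theorem thetaVec_zero_T_zpow (n : ℤ) (τ : ℍ) :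
    thetaVec ((Mp2Z.T ^ n).mat • τ) 0 = thetaVec τ 0 := by
  have h (σ : ℍ) : thetaVec (Mp2Z.T.mat • σ) 0 = thetaVec σ 0 := by
    rw [show Mp2Z.T.mat = ModularGroup.T from rfl, thetaVec_T]
    simp [weilT, Matrix.mulVec, dotProduct, Fin.sum_univ_two]
  induction n generalizing τ with
  | zero => simp
  | succ n ih => rw [_root_.zpow_add_one, Mp2Z.mul_mat, mul_smul, ih, h]
  | pred n ih => rw [_root_.zpow_sub_one, Mp2Z.mul_mat, mul_smul, ih, ← h, Mp2Z.inv_mat, smul_inv_smul]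

/-- Up to sign the matrix is `S T⁻⁴ S`, and `ρ₁(T⁴) = 1`, so `ρ₁` acts by the scalar `ρ₁(S)² = -i`.
This scalar accounts for the passage from the root of `-(4τ + 1)` to that of `4τ + 1`. -/
theorem thetaVec_zero_lowerFour (τ : ℍ) :
    thetaVec (lowerFour.mat • τ) 0 = lowerFour.phi τ * thetaVec τ 0 := by
  set B : Mp2Z := Mp2Z.S * Mp2Z.T ^ (-4 : ℤ) * Mp2Z.S with hB
  have hm : B.mat = -lowerFour.mat := by
    rw [hB, Mp2Z.mul_mat, Mp2Z.mul_mat, T_zpow_mat]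
    ext i k
    rw [sl_mul_apply, sl_mul_apply, sl_mul_apply, ModularGroup.coe_T_zpow]
    rw [show (-lowerFour.mat) i k = -lowerFour.mat i k from rfl]
    fin_cases i <;> fin_cases k <;> simp [Mp2Z.S, ModularGroup.S, lowerFour, principalLift]
  have hρ : (weilRep B : Matrix (Fin 2) (Fin 2) ℂ) = (-I) • 1 := by
    rw [hB, map_mul, map_mul, _root_.zpow_neg, map_inv, weilRep_T_pow_four, inv_one, mul_one,
      Units.val_mul, weilRep_S]
    have h1 : ((1 - I) / 2) * ((1 - I) / 2) = -I / 2 := by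
      ring_nf; rw [I_sq]; ring
    rw [Matrix.smul_mul, Matrix.mul_smul, smul_smul, h1]
    ext i k
    fin_cases i <;> fin_cases k <;> simp
    all_goals ring
  have h := congrFun (thetaVec_smul B τ) 0
  rw [hρ, hm, ModularGroup.SL_neg_smul] at h
  have hphi : lowerFour.phi τ = -I * B.phi τ := by
    refine sqrt_eq_of_re_pos ?_ ?_
    · rw [mul_pow, B.sq_phi, neg_sq, I_sq, hm]
      have h0 : j (-lowerFour.mat) τ = -j lowerFour.mat τ := by
        simp only [j, show ∀ i k, (-lowerFour.mat) i k = -lowerFour.mat i k from fun _ _ => rfl]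
        push_cast; ring
      rw [h0, neg_one_mul, neg_neg]; rfl
    -- `B.phi τ` is a product of two principal roots of points of the upper half-plane, both in the
    -- first quadrant, so its imaginary part is positive; this is the real part of `-I * B.phi τ`.
    · have h1 : B.phi τ = ((((Mp2Z.T ^ (-4 : ℤ)).mat • Mp2Z.S.mat • τ : ℍ)) : ℂ) ^ (1 / 2 : ℂ) *
          (τ : ℂ) ^ (1 / 2 : ℂ) := by
        rw [hB, Mp2Z.mul_phi, Mp2Z.mul_phi, T_zpow_phi, mul_one]; rfl
      rw [h1]
      set σ := (Mp2Z.T ^ (-4 : ℤ)).mat • Mp2Z.S.mat • τ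
      have := sqrt_re_pos τ.im_pos.ne'
      have := sqrt_re_pos σ.im_pos.ne'
      have := sqrt_im_pos τ.im_pos
      have := sqrt_im_pos σ.im_pos
      simp only [mul_re, neg_re, Complex.I_re, neg_im, Complex.I_im, mul_im]
      nlinarith
  rw [h, hphi]
  simp
  ring

theorem thetaVec_zero_smul_mul {A B : Mp2Z} (hpsi : psi (A * B) = psi A)
    (hB : ∀ τ, thetaVec (B.mat • τ) 0 = B.phi τ * thetaVec τ 0)
    (hA : ∀ τ, thetaVec (A.mat • τ) 0 = psi A * A.phi τ * thetaVec τ 0) (τ : ℍ) :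
    thetaVec ((A * B).mat • τ) 0 = psi (A * B) * (A * B).phi τ * thetaVec τ 0 := by
  rw [Mp2Z.mul_mat, mul_smul, hA, hB, hpsi, Mp2Z.mul_phi]; ring

theorem thetaVec_zero_smul_of_mul {A B : Mp2Z} (hpsi : psi (A * B) = psi A)
    (hB : ∀ τ, thetaVec (B.mat • τ) 0 = B.phi τ * thetaVec τ 0)
    (hA : ∀ τ, thetaVec ((A * B).mat • τ) 0 = psi (A * B) * (A * B).phi τ * thetaVec τ 0)
    (τ : ℍ) : thetaVec (A.mat • τ) 0 = psi A * A.phi τ * thetaVec τ 0 := by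
  have h := hA (B.mat⁻¹ • τ)
  have h2 := hB (B.mat⁻¹ • τ)
  rw [smul_inv_smul] at h2
  rw [Mp2Z.mul_mat, mul_smul, Mp2Z.mul_phi, smul_inv_smul] at h
  rw [h, hpsi, h2]; ring

theorem thetaVec_zero_smul_of_lower_left_eq_zero {A : Mp2Z} (hA : A.mat 1 0 = 0) (τ : ℍ) :
    thetaVec (A.mat • τ) 0 = psi A * A.phi τ * thetaVec τ 0 := by
  obtain ⟨n, hn⟩ := ModularGroup.exists_eq_T_zpow_of_c_eq_zero hA
  rw [hn, ← T_zpow_mat, thetaVec_zero_T_zpow, phi_eq_rootSign_mul, psi_eq, hA]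
  have hs := rootSign_mul_self A
  rcases lower_right_unit_of_lower_left_eq_zero hA with h | h
  · rw [j, hA, h]
    simp [quadSymbol, epsSymbol]
    rw [hs, one_mul]
  · rw [j, hA, h]
    -- For `d = -1` the principal root of `-1` is `i`, and it cancels against `conj ε_d = -i`.
    have h1 : ((0 : ℤ) : ℂ) * τ + ((-1 : ℤ) : ℂ) = -1 := by push_cast; ring
    rw [h1, sqrt_neg_one]
    simp [quadSymbol, epsSymbol]
    linear_combination (thetaVec τ 0 * I * I) * hs + thetaVec τ 0 * I_mul_I

theorem mul_T_inv_lower (A : Mp2Z) : (A * Mp2Z.T⁻¹).mat 1 0 = A.mat 1 0 ∧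
    (A * Mp2Z.T⁻¹).mat 1 1 = A.mat 1 1 - A.mat 1 0 := by
  obtain ⟨h1, h2⟩ := mul_T_lower (A * Mp2Z.T⁻¹)
  rw [inv_mul_cancel_right] at h1 h2
  exact ⟨h1.symm, by omega⟩

theorem mul_lowerFour_inv_lower (A : Mp2Z) :
    (A * lowerFour⁻¹).mat 1 0 = A.mat 1 0 - 4 * A.mat 1 1 ∧
    (A * lowerFour⁻¹).mat 1 1 = A.mat 1 1 := by
  obtain ⟨h1, h2⟩ := mul_lowerFour_lower (A * lowerFour⁻¹)
  rw [inv_mul_cancel_right] at h1 h2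
  exact ⟨by omega, h2.symm⟩

/-- The transformation law of `θ = ∑ q^{n²}` under the inverse image of `Γ₀(4)`. -/
theorem thetaVec_zero_smul (A : Mp2Z) (hA : 4 ∣ A.mat 1 0) (τ : ℍ) :
    thetaVec (A.mat • τ) 0 = psi A * A.phi τ * thetaVec τ 0 := by
  -- Euclidean descent on `|c| + |d|`: right multiplication by `T^{±1}` replaces `d` by `d ± c`, and
  -- by `lowerFour^{±1}` replaces `c` by `c ± 4d`. Neither changes `ψ`.
  induction hn : (A.mat 1 0).natAbs + (A.mat 1 1).natAbs using Nat.strong_induction_on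
    generalizing A τ with
  | _ n ih =>
  have hT (τ : ℍ) : thetaVec (Mp2Z.T.mat • τ) 0 = Mp2Z.T.phi τ * thetaVec τ 0 := by
    have := thetaVec_zero_T_zpow 1 τ
    rw [zpow_one] at this
    rw [this]; simp [Mp2Z.T]
  by_cases hc : A.mat 1 0 = 0
  · exact thetaVec_zero_smul_of_lower_left_eq_zero hc τ
  have hodd := Int.odd_iff.mp (lower_right_odd hA)
  have hTA : psi (A * Mp2Z.T) = psi A := psi_mul_T hA
  have hTA' : psi (A * Mp2Z.T⁻¹ * Mp2Z.T) = psi (A * Mp2Z.T⁻¹) :=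
    psi_mul_T ((mul_T_inv_lower A).1 ▸ hA)
  have hV' : psi (A * lowerFour⁻¹ * lowerFour) = psi (A * lowerFour⁻¹) := psi_mul_lowerFour
  obtain ⟨t1, t2⟩ := mul_T_lower A
  obtain ⟨t3, t4⟩ := mul_T_inv_lower A
  obtain ⟨v1, v2⟩ := mul_lowerFour_lower A
  obtain ⟨v3, v4⟩ := mul_lowerFour_inv_lower A
  -- Equality `|c| = 2|d|` is impossible, since `4 ∣ c` and `d` is odd. In the first case `|d|` can
  -- be lowered, in the second `|c|`; the relative sign of `c` and `d` selects the direction.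
  rcases (by omega : (A.mat 1 0).natAbs < 2 * (A.mat 1 1).natAbs ∨
    2 * (A.mat 1 1).natAbs < (A.mat 1 0).natAbs) with h | h <;>
    rcases (by omega : (0 < A.mat 1 0 ∧ 0 < A.mat 1 1 ∨ A.mat 1 0 < 0 ∧ A.mat 1 1 < 0) ∨
      0 < A.mat 1 0 ∧ A.mat 1 1 < 0 ∨ A.mat 1 0 < 0 ∧ 0 < A.mat 1 1) with hs | hs
  · have := thetaVec_zero_smul_mul hTA' hT
      (fun σ => ih _ (by omega) (A * Mp2Z.T⁻¹) (by omega) σ rfl) τ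
    rwa [inv_mul_cancel_right] at this
  · exact thetaVec_zero_smul_of_mul hTA hT
      (fun σ => ih _ (by omega) (A * Mp2Z.T) (by omega) σ rfl) τ
  · have := thetaVec_zero_smul_mul hV' thetaVec_zero_lowerFour
      (fun σ => ih _ (by omega) (A * lowerFour⁻¹) (by omega) σ rfl) τ
    rwa [inv_mul_cancel_right] at this
  · exact thetaVec_zero_smul_of_mul psi_mul_lowerFour thetaVec_zero_lowerFour
      (fun σ => ih _ (by omega) (A * lowerFour) (by omega) σ rfl) τ

/-! ### The values of `ψ` are fourth roots of unity. -/

theorem quadSymbol_sq {c d : ℤ} (h : IsCoprime c d) : quadSymbol c d ^ 2 = 1 := by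
  have h1 : jacobiSym c d.natAbs ^ 2 = 1 := jacobiSym.sq_one (by
    rw [Int.isCoprime_iff_gcd_eq_one] at h
    simpa [Int.gcd, Int.natAbs_abs] using h)
  unfold quadSymbol
  split_ifs
  · rw [neg_sq, h1]
  · exact h1

theorem isCoprime_lower (α : SL(2, ℤ)) : IsCoprime (α 1 0) (α 1 1) :=
  ⟨-α 0 1, α 0 0, by linear_combination det_eq_one α⟩

theorem psi_sq (A : Mp2Z) : psi A ^ 2 = if A.mat 1 1 % 4 = 1 then 1 else -1 := by
  have h1 := rootSign_mul_self A
  have h2 : (quadSymbol (A.mat 1 0) (A.mat 1 1) : ℂ) ^ 2 = 1 := by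
    exact_mod_cast quadSymbol_sq (isCoprime_lower A.mat)
  have h3 : conj (epsSymbol (A.mat 1 1)) ^ 2 = if A.mat 1 1 % 4 = 1 then 1 else -1 := by
    unfold epsSymbol
    split_ifs <;> simp
  rw [psi_eq, mul_pow, mul_pow, sq (rootSign A), h1, h2, h3]
  ring

theorem psi_pow_four (A : Mp2Z) : psi A ^ 4 = 1 := by
  rw [show 4 = 2 * 2 from rfl, pow_mul, psi_sq]
  split_ifs <;> norm_num

theorem psi_ne_zero (A : Mp2Z) : psi A ≠ 0 := fun h => by
  have := psi_pow_four A
  rw [h] at this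
  norm_num at this

theorem conj_psi (A : Mp2Z) : conj (psi A) = (psi A)⁻¹ := by
  have h : ‖psi A‖ = 1 := by
    have := congrArg norm (psi_pow_four A)
    rw [norm_pow, norm_one] at this
    exact (pow_eq_one_iff_of_nonneg (norm_nonneg _) (by norm_num)).mp this
  exact (inv_eq_conj h).symm

theorem psi_zpow_eq (A : Mp2Z) {n m : ℤ} (h : (4 : ℤ) ∣ n - m) : psi A ^ n = psi A ^ m := by
  obtain ⟨r, hr⟩ := h
  rw [show n = 4 * r + m by omega, zpow_add₀ (psi_ne_zero A), _root_.zpow_mul]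
  rw [show psi A ^ (4 : ℤ) = 1 by exact_mod_cast psi_pow_four A, _root_.one_zpow, one_mul]

/-! ### Conjugation by `τ ↦ 4 τ` -/

/-- The point `4 τ`. -/
def fourTimes (τ : ℍ) : ℍ := ⟨4 * τ, by simpa using τ.im_pos⟩

/-- The point `τ / 4`. -/
def quarter (τ : ℍ) : ℍ := ⟨τ / 4, by simpa using τ.im_pos⟩

@[simp] theorem coe_fourTimes (τ : ℍ) : (fourTimes τ : ℂ) = 4 * τ := rfl

@[simp] theorem coe_quarter (τ : ℍ) : (quarter τ : ℂ) = τ / 4 := rfl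

@[simp] theorem fourTimes_quarter (τ : ℍ) : fourTimes (quarter τ) = τ := by
  ext; simp; ring

@[simp] theorem quarter_fourTimes (τ : ℍ) : quarter (fourTimes τ) = τ := by
  ext; simp

/-- The relation `B = δ A δ⁻¹`, where `δ` is the map `τ ↦ 4 τ`. -/
structure IsFourConj (A B : Mp2Z) : Prop where
  a : B.mat 0 0 = A.mat 0 0
  b : B.mat 0 1 = 4 * A.mat 0 1
  c : A.mat 1 0 = 4 * B.mat 1 0
  d : B.mat 1 1 = A.mat 1 1
  phi : ∀ τ, A.phi τ = B.phi (fourTimes τ)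

theorem coe_SL_smul (α : SL(2, ℤ)) (τ : ℍ) :
    ((α • τ : ℍ) : ℂ) = (α 0 0 * τ + α 0 1) / (α 1 0 * τ + α 1 1) := by
  rw [UpperHalfPlane.specialLinearGroup_apply]; simp

theorem mdifferentiable_comp_scale {g : ℍ → ℂ} {s : ℍ → ℍ} (u : ℂ → ℂ)
    (hu : Differentiable ℂ u) (hs : ∀ τ, (s τ : ℂ) = u τ)
    (hg : MDifferentiable (modelWithCornersSelf ℂ ℂ) (modelWithCornersSelf ℂ ℂ) g) :
    MDifferentiable (modelWithCornersSelf ℂ ℂ) (modelWithCornersSelf ℂ ℂ) (fun τ => g (s τ)) := by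
  rw [mdifferentiable_iff] at hg ⊢
  have him : ∀ z : ℂ, 0 < z.im → u z = s (ofComplex z) := fun z hz => by
    rw [hs, ofComplex_apply_of_im_pos hz]
  refine (hg.comp hu.differentiableOn (t := {z | 0 < z.im}) ?_).congr ?_
  · intro z hz
    change 0 < (u z).im
    rw [him z hz]; exact (s _).im_pos
  · intro z hz
    simp only [Function.comp_apply]
    rw [him z hz, ofComplex_apply]

theorem exists_isFourConj_of_lower {A : Mp2Z} (h : 4 ∣ A.mat 1 0) : ∃ B, IsFourConj A B := by
  obtain ⟨c, hc⟩ := h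
  have hd := det_eq_one A.mat
  refine ⟨⟨⟨!![A.mat 0 0, 4 * A.mat 0 1; c, A.mat 1 1], ?_⟩, fun τ => A.phi (quarter τ),
    mdifferentiable_comp_scale (fun z => z / 4) (by fun_prop) coe_quarter A.holo, fun τ => ?_⟩,
    ⟨?_, ?_, ?_, ?_, fun τ => ?_⟩⟩
  · rw [hc] at hd; rw [Matrix.det_fin_two_of]; linear_combination hd
  · rw [A.sq_phi]; simp [j, hc]; ring
  all_goals simp [hc]

theorem exists_isFourConj_of_upper {B : Mp2Z} (h : 4 ∣ B.mat 0 1) : ∃ A, IsFourConj A B := by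
  obtain ⟨b, hb⟩ := h
  have hd := det_eq_one B.mat
  refine ⟨⟨⟨!![B.mat 0 0, b; 4 * B.mat 1 0, B.mat 1 1], ?_⟩, fun τ => B.phi (fourTimes τ),
    mdifferentiable_comp_scale (fun z => 4 * z) (by fun_prop) coe_fourTimes B.holo, fun τ => ?_⟩,
    ⟨?_, ?_, ?_, ?_, fun τ => ?_⟩⟩
  · rw [hb] at hd; rw [Matrix.det_fin_two_of]; linear_combination hd
  · rw [B.sq_phi]; simp [j]; ring
  all_goals simp [hb]

theorem IsFourConj.fourTimes_smul {A B : Mp2Z} (h : IsFourConj A B) (τ : ℍ) :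
    fourTimes (A.mat • τ) = B.mat • fourTimes τ := by
  ext
  rw [coe_fourTimes, coe_SL_smul, coe_SL_smul, coe_fourTimes, h.a, h.b, h.c, h.d]
  push_cast
  have : ((4 * B.mat 1 0 : ℤ) : ℂ) * τ + A.mat 1 1 ≠ 0 := by
    have := j_ne_zero A.mat τ
    rwa [j, h.c] at this
  push_cast at this
  rw [mul_div_assoc']
  congr 1 <;> ring

/-- This splits `∑ q^{n²}` by the parity of `n`. -/
theorem thetaVec_fourTimes_sum (τ : ℍ) :
    thetaVec (fourTimes τ) 0 + thetaVec (fourTimes τ) 1 = thetaVec τ 0 := by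
  have h := theta_split 0 (fourTimes τ) (fourTimes τ).im_pos
  have h2 : (fourTimes τ : ℂ) / 2 = 2 * τ := by rw [coe_fourTimes]; ring
  rw [h2] at h
  simp only [thetaVec, Matrix.cons_val_zero, Matrix.cons_val_one]
  rw [h]
  simp

/-- Evaluating `θ(Aτ)` by the multiplier `ψ(A)` and, through `4τ`, by `ρ₁(B)` gives a linear
relation between the theta entries, whose coefficients must vanish. -/
theorem IsFourConj.weilRep_col {A B : Mp2Z} (h : IsFourConj A B) (i : Fin 2) :
    (weilRep B : Matrix (Fin 2) (Fin 2) ℂ) 0 i + (weilRep B : Matrix (Fin 2) (Fin 2) ℂ) 1 i =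
      psi A := by
  set M := (weilRep B : Matrix (Fin 2) (Fin 2) ℂ) with hM
  have key : (fun i => M 0 i + M 1 i - psi A) = 0 := by
    refine thetaVec_indep _ fun τ => ?_
    obtain ⟨τ, rfl⟩ : ∃ σ, τ = fourTimes σ := ⟨quarter τ, by simp⟩
    have h1 := thetaVec_zero_smul A ⟨_, h.c⟩ τ
    rw [← thetaVec_fourTimes_sum, h.fourTimes_smul, thetaVec_smul, ← thetaVec_fourTimes_sum τ,
      ← h.phi, ← hM] at h1
    simp only [Matrix.mulVec, dotProduct, Fin.sum_univ_two, Pi.smul_apply, smul_eq_mul] at h1 ⊢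
    refine (mul_eq_zero.mp ?_).resolve_left (A.phi_ne_zero τ)
    linear_combination h1
  exact sub_eq_zero.mp (congrFun key i)

/-- The row vector `(1, 1)` is an eigenvector of `ρ_ε` on the conjugate of `Γ̃₀(4)`. -/
theorem IsFourConj.vectorRep_sum {A B : Mp2Z} (h : IsFourConj A B) (ε : ℤˣ) (v : Fin 2 → ℂ) :
    vectorRep ε B v 0 + vectorRep ε B v 1 = psi A ^ (ε : ℤ) * (v 0 + v 1) := by
  have h0 := h.weilRep_col 0
  have h1 := h.weilRep_col 1
  rcases Int.units_eq_one_or ε with rfl | rfl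
  · simp only [vectorRep, weilRepSign, if_true, Matrix.mulVecLin_apply, Matrix.mulVec, dotProduct,
      Fin.sum_univ_two, Units.val_one, zpow_one]
    linear_combination v 0 * h0 + v 1 * h1
  -- For the dual representation the identity is conjugated; `ψ` has absolute value one, so its
  -- conjugate is its inverse.
  · have h0' := congrArg conj h0
    have h1' := congrArg conj h1
    rw [map_add, conj_psi] at h0' h1'
    have hne : (-1 : ℤˣ) ≠ 1 := by decide
    simp only [vectorRep, weilRepSign, if_neg hne, Matrix.mulVecLin_apply, Matrix.mulVec,
      dotProduct, Fin.sum_univ_two, Units.val_neg, Units.val_one, _root_.zpow_neg, zpow_one,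
      MonoidHom.comp_apply, Matrix.GeneralLinearGroup.map_apply]
    linear_combination v 0 * h0' + v 1 * h1'

/-! ### The transformation law of a vector valued function from that of the sum of its entries -/

theorem vectorRep_mul (ε : ℤˣ) (A B : Mp2Z) (v : Fin 2 → ℂ) :
    vectorRep ε (A * B) v = vectorRep ε A (vectorRep ε B v) := by
  simp [vectorRep]

theorem vectorRep_one (ε : ℤˣ) (v : Fin 2 → ℂ) : vectorRep ε 1 v = v := by
  simp [vectorRep]

theorem vectorRep_T (ε : ℤˣ) (v : Fin 2 → ℂ) :
    vectorRep ε Mp2Z.T v = ![v 0, I ^ (ε : ℤ) * v 1] := by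
  have h (x : ℂ) : (!![1, 0; 0, x] : Matrix (Fin 2) (Fin 2) ℂ) *ᵥ v = ![v 0, x * v 1] := by
    ext i; fin_cases i <;> simp [Matrix.mulVec, dotProduct, Fin.sum_univ_two]
  rcases Int.units_eq_one_or ε with rfl | rfl
  · simp only [vectorRep, weilRepSign, if_true, Matrix.mulVecLin_apply, weilRep_T, h]
    simp
  · have hne : (-1 : ℤˣ) ≠ 1 := by decide
    have h1 : ((Matrix.GeneralLinearGroup.map (starRingEnd ℂ)).comp weilRep Mp2Z.T :
        Matrix (Fin 2) (Fin 2) ℂ) = !![1, 0; 0, I ^ (-1 : ℤ)] := by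
      ext i k
      rw [MonoidHom.comp_apply, Matrix.GeneralLinearGroup.map_apply, weilRep_T]
      fin_cases i <;> fin_cases k <;> simp
    simp only [vectorRep, weilRepSign, if_neg hne, Matrix.mulVecLin_apply, h1, h]
    simp

theorem I_zpow_sign_sq (ε : ℤˣ) : (I ^ (ε : ℤ)) ^ 2 = -1 := by
  rcases Int.units_eq_one_or ε with rfl | rfl <;> simp

theorem I_zpow_sign_ne_zero (ε : ℤˣ) : I ^ (ε : ℤ) ≠ 0 := zpow_ne_zero _ I_ne_zero

theorem vectorRep_T_zpow (ε : ℤˣ) (n : ℤ) (v : Fin 2 → ℂ) :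
    vectorRep ε (Mp2Z.T ^ n) v = ![v 0, (I ^ (ε : ℤ)) ^ n * v 1] := by
  have hne := I_zpow_sign_ne_zero ε
  have hinv (w : Fin 2 → ℂ) : vectorRep ε Mp2Z.T⁻¹ w = ![w 0, (I ^ (ε : ℤ))⁻¹ * w 1] := by
    have h : vectorRep ε Mp2Z.T ![w 0, (I ^ (ε : ℤ))⁻¹ * w 1] = w := by
      rw [vectorRep_T]; ext i; fin_cases i <;> simp [hne]
    conv_lhs => rw [← h]
    rw [← vectorRep_mul, inv_mul_cancel, vectorRep_one]
  induction n generalizing v with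
  | zero => rw [zpow_zero, vectorRep_one]; ext i; fin_cases i <;> simp
  | succ n ih =>
    rw [_root_.zpow_add_one, vectorRep_mul, vectorRep_T, ih, zpow_add_one₀ hne]
    simp [mul_assoc]
  | pred n ih =>
    rw [_root_.zpow_sub_one, vectorRep_mul, hinv, ih, zpow_sub_one₀ hne]
    simp [mul_assoc]

theorem T_zpow_mul_mul_T_zpow_mat (A : Mp2Z) (n n' : ℤ) :
    (Mp2Z.T ^ n * A * Mp2Z.T ^ n').mat 0 1 =
        (A.mat 0 0 + n * A.mat 1 0) * n' + (A.mat 0 1 + n * A.mat 1 1) ∧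
      (Mp2Z.T ^ n * A * Mp2Z.T ^ n').mat 1 0 = A.mat 1 0 ∧
      (Mp2Z.T ^ n * A * Mp2Z.T ^ n').mat 1 1 = A.mat 1 1 + n' * A.mat 1 0 := by
  simp only [Mp2Z.mul_mat, T_zpow_mat, sl_mul_apply, ModularGroup.coe_T_zpow]
  simp
  ring

theorem T_zpow_equivariant {ε : ℤˣ} {F : ℍ → Fin 2 → ℂ}
    (hT : ∀ τ, F (Mp2Z.T.mat • τ) = vectorRep ε Mp2Z.T (F τ)) (n : ℤ) (τ : ℍ) :
    F ((Mp2Z.T ^ n).mat • τ) = vectorRep ε (Mp2Z.T ^ n) (F τ) := by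
  induction n generalizing τ with
  | zero => simp [vectorRep_one]
  | succ n ih => rw [_root_.zpow_add_one, Mp2Z.mul_mat, mul_smul, ih, hT, vectorRep_mul]
  | pred n ih =>
    have h := hT (Mp2Z.T⁻¹.mat • τ)
    rw [Mp2Z.inv_mat, smul_inv_smul] at h
    rw [_root_.zpow_sub_one, Mp2Z.mul_mat, mul_smul, ih, h, ← vectorRep_mul,
      inv_mul_cancel_right, Mp2Z.inv_mat]

/-- The hypothesis `hF` controls only the sum of the entries, and only for matrices with `4 ∣ b`.
Equivariance under `T` recovers the rest, because `T` acts on the two coordinates with different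
eigenvalues. -/
theorem transform_of_sum_transform {Γ : Subgroup Mp2Z} (hTΓ : Mp2Z.T ∈ Γ) {m : ℤ} {ε : ℤˣ}
    {μ : Mp2Z → ℂ} (hμ : ∀ A ∈ Γ, ∀ n n' : ℤ, μ (Mp2Z.T ^ n * A * Mp2Z.T ^ n') = μ A)
    {F : ℍ → Fin 2 → ℂ} (hT : ∀ τ, F (Mp2Z.T.mat • τ) = vectorRep ε Mp2Z.T (F τ))
    (hF : ∀ A B, IsFourConj A B → B ∈ Γ → ∀ τ, F (B.mat • τ) 0 + F (B.mat • τ) 1 =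
      B.phi τ ^ m * (psi A ^ (ε : ℤ) * μ B * (F τ 0 + F τ 1)))
    {A : Mp2Z} (hA : A ∈ Γ) (τ : ℍ) :
    F (A.mat • τ) = A.phi τ ^ m • (μ A • vectorRep ε A (F τ)) := by
  let D (A : Mp2Z) (τ : ℍ) : Fin 2 → ℂ :=
    F (A.mat • τ) - A.phi τ ^ m • (μ A • vectorRep ε A (F τ))
  have h1 (B : Mp2Z) (hB : B ∈ Γ) (h4 : 4 ∣ B.mat 0 1) (τ : ℍ) : D B τ 0 + D B τ 1 = 0 := by
    obtain ⟨A, h⟩ := exists_isFourConj_of_upper h4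
    have h2 := hF A B h hB τ
    have h3 := h.vectorRep_sum ε (F τ)
    simp only [D, Pi.sub_apply, Pi.smul_apply, smul_eq_mul]
    linear_combination h2 - B.phi τ ^ m * μ B * h3
  have h2 (n n' : ℤ) (τ : ℍ) : D (Mp2Z.T ^ n * A * Mp2Z.T ^ n') τ =
      vectorRep ε (Mp2Z.T ^ n) (D A ((Mp2Z.T ^ n').mat • τ)) := by
    simp only [D]
    rw [hμ A hA, map_sub, map_smul, map_smul, Mp2Z.mul_phi, Mp2Z.mul_phi, T_zpow_phi, T_zpow_phi,
      one_mul, mul_one, vectorRep_mul, vectorRep_mul, ← T_zpow_equivariant hT,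
      ← T_zpow_equivariant hT, Mp2Z.mul_mat, Mp2Z.mul_mat, mul_smul, mul_smul]
  have h3 (n : ℤ) (hn : Odd (A.mat 0 0 + n * A.mat 1 0)) :
      D A τ 0 + (I ^ (ε : ℤ)) ^ n * D A τ 1 = 0 := by
    set u := A.mat 0 0 + n * A.mat 1 0 with hu
    set v := A.mat 0 1 + n * A.mat 1 1 with hv
    -- The exponent `-(u v)` makes the upper right entry `(1 - u²) v`, which is divisible by `4`
    -- because `u` is odd.
    have h5 := h2 n (-(u * v)) ((Mp2Z.T ^ (-(u * v))).mat⁻¹ • τ)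
    rw [smul_inv_smul, vectorRep_T_zpow] at h5
    rw [← h1 (Mp2Z.T ^ n * A * Mp2Z.T ^ (-(u * v)))
      (mul_mem (mul_mem (zpow_mem hTΓ _) hA) (zpow_mem hTΓ _)) _
      ((Mp2Z.T ^ (-(u * v))).mat⁻¹ • τ), h5]
    · simp
    · rw [(T_zpow_mul_mul_T_zpow_mat A _ _).1, ← hu, ← hv]
      obtain ⟨w, hw⟩ := hn
      exact ⟨-(w * w + w) * v, by rw [hw]; ring⟩
  -- The entries `a` and `c` are not both even, since the determinant is `1`.
  obtain ⟨n, hn⟩ : ∃ n : ℤ, Odd (A.mat 0 0 + n * A.mat 1 0) := by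
    have hd := det_eq_one A.mat
    by_cases h0 : Odd (A.mat 0 0)
    · exact ⟨0, by simpa using h0⟩
    · refine ⟨1, ?_⟩
      rw [Int.not_odd_iff_even] at h0
      have h4 : Odd (A.mat 1 0) := by
        by_contra h
        rw [Int.not_odd_iff_even] at h
        have : Even (1 : ℤ) := hd ▸ (h0.mul_right _).sub (h.mul_left _)
        exact absurd this (by decide)
      rw [one_mul]; exact h0.add_odd h4
  have h4 := h3 n hn
  -- Adding `2` to `n` keeps the parity of `a + n c` and flips the sign of `i^{εn}`.
  have h5 := h3 (n + 2) (by
    rw [add_mul, ← add_assoc]; exact hn.add_even (even_two.mul_right _))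
  rw [zpow_add₀ (I_zpow_sign_ne_zero ε), show (I ^ (ε : ℤ)) ^ (2 : ℤ) = -1 by
    exact_mod_cast I_zpow_sign_sq ε] at h5
  have hne : (I ^ (ε : ℤ)) ^ n ≠ 0 := zpow_ne_zero _ (I_zpow_sign_ne_zero ε)
  have e0 : D A τ 0 = 0 := by linear_combination (h4 + h5) / 2
  have e1 : D A τ 1 = 0 := by
    rw [e0, zero_add] at h4
    exact (mul_eq_zero.mp h4).resolve_left hne
  refine sub_eq_zero.mp (?_ : D A τ = 0)
  ext i; fin_cases i <;> [exact e0; exact e1]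

/-! ### Fourier series -/

theorem fourierCoeffOn_zero_one (g : ℝ → ℂ) (n : ℤ) : fourierCoeffOn zero_lt_one g n =
    ∫ x in (0 : ℝ)..1, g x * cexp (-(2 * Real.pi * I * n * x)) := by
  rw [fourierCoeffOn_eq_integral, sub_zero, one_div_one, one_smul]
  refine intervalIntegral.integral_congr fun x _ => ?_
  simp only [smul_eq_mul]
  rw [fourier_coe_apply, mul_comm]
  congr 2
  push_cast
  ring

theorem periodic_deriv {g : ℝ → ℂ} (hp : Function.Periodic g 1) : Function.Periodic (deriv g) 1 :=
  fun x => by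
    rw [← deriv_comp_add_const]
    congr 1
    exact funext hp

theorem fourierCoeffOn_deriv {g : ℝ → ℂ} (hg : ContDiff ℝ 1 g) (hp : Function.Periodic g 1)
    {n : ℤ} (hn : n ≠ 0) : fourierCoeffOn zero_lt_one g n =
      (2 * Real.pi * I * n)⁻¹ * fourierCoeffOn zero_lt_one (deriv g) n := by
  have h := fourierCoeffOn_of_hasDerivAt zero_lt_one (f := g) (f' := deriv g) hn
    (fun x _ => (hg.differentiable one_ne_zero x).hasDerivAt)
    ((hg.continuous_deriv le_rfl).intervalIntegrable 0 1)
  have h0 : g 1 = g 0 := by simpa using hp 0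
  rw [h, h0, sub_self, mul_zero, zero_sub]
  push_cast
  rw [sub_zero, one_mul, one_div, show (-2 * Real.pi * I * n : ℂ) = -(2 * Real.pi * I * n) by ring,
    inv_neg]
  ring

theorem norm_fourierCoeffOn_le {g : ℝ → ℂ} (hg : Continuous g) :
    ∃ C : ℝ, ∀ n : ℤ, ‖fourierCoeffOn zero_lt_one g n‖ ≤ C := by
  obtain ⟨C, hC⟩ := (isCompact_Icc (a := (0 : ℝ)) (b := 1)).exists_bound_of_continuousOn
    hg.continuousOn
  refine ⟨C, fun n => ?_⟩
  rw [fourierCoeffOn_zero_one]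
  have := intervalIntegral.norm_integral_le_of_norm_le_const (a := (0 : ℝ)) (b := 1) (C := C)
    (f := fun x : ℝ => g x * cexp (-(2 * Real.pi * I * n * x))) fun x hx => by
      rw [Set.uIoc_of_le zero_le_one] at hx
      rw [norm_mul, norm_exp]
      simpa using hC x ⟨hx.1.le, hx.2⟩
  simpa using this

/-- Two integrations by parts, without boundary terms by periodicity, bound the coefficients by a
multiple of `1/n²` away from `n = 0`. -/
theorem summable_fourierCoeffOn {g : ℝ → ℂ} (hg : ContDiff ℝ 2 g) (hp : Function.Periodic g 1) :
    Summable fun n : ℤ => fourierCoeffOn zero_lt_one g n := by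
  have hg' : ContDiff ℝ 1 (deriv g) := (contDiff_succ_iff_deriv (n := 1)).mp hg |>.2.2
  obtain ⟨C, hC⟩ := norm_fourierCoeffOn_le (hg'.continuous_deriv le_rfl)
  have hs : Summable fun n : ℤ => C * (1 / (n : ℝ) ^ 2) :=
    (Real.summable_one_div_int_pow.mpr one_lt_two).mul_left C
  refine Summable.of_norm_bounded_eventually hs ?_
  have hfin : ({0} : Set ℤ).Finite := Set.finite_singleton 0
  filter_upwards [hfin.compl_mem_cofinite] with n hn
  have hn0 : n ≠ 0 := hn
  rw [fourierCoeffOn_deriv (hg.of_le one_le_two) hp hn0,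
    fourierCoeffOn_deriv hg' (periodic_deriv hp) hn0, ← mul_assoc, norm_mul, mul_comm]
  refine mul_le_mul (hC n) ?_ (norm_nonneg _) ((norm_nonneg _).trans (hC n))
  have h1 : ‖(2 * Real.pi * I * n : ℂ)⁻¹‖ = (2 * Real.pi * |(n : ℝ)|)⁻¹ := by
    simp [abs_of_pos Real.pi_pos]
  rw [norm_mul, h1, ← mul_inv, ← one_div]
  have hn1 : 0 < |(n : ℝ)| := abs_pos.mpr (by exact_mod_cast hn0)
  refine one_div_le_one_div_of_le (by positivity) ?_
  rw [← sq_abs]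
  have h2 : 1 ≤ 2 * Real.pi := by linarith [Real.pi_gt_three]
  nlinarith [mul_le_mul h2 h2 zero_le_one (by linarith), sq_nonneg |(n : ℝ)|]

theorem hasSum_fourier_of_contDiff {g : ℝ → ℂ} (hg : ContDiff ℝ 2 g)
    (hp : Function.Periodic g 1) (x : ℝ) : HasSum (fun n : ℤ =>
      (∫ t in (0 : ℝ)..1, g t * cexp (-(2 * Real.pi * I * n * t))) *
        cexp (2 * Real.pi * I * n * x)) (g x) := by
  have : Fact ((0 : ℝ) < 1) := ⟨zero_lt_one⟩
  let G : C(AddCircle (1 : ℝ), ℂ) := ⟨hp.lift, continuous_coinduced_dom.mpr hg.continuous⟩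
  have hG : ∀ n : ℤ, fourierCoeff G n =
      ∫ t in (0 : ℝ)..1, g t * cexp (-(2 * Real.pi * I * n * t)) := fun n => by
    rw [fourierCoeff_eq_intervalIntegral _ _ 0, zero_add, one_div_one, one_smul]
    refine intervalIntegral.integral_congr fun t _ => ?_
    simp only [smul_eq_mul]
    rw [fourier_coe_apply, mul_comm]
    congr 2
    push_cast
    ring
  have hs : Summable (fourierCoeff G) := by
    have := summable_fourierCoeffOn hg hp
    simp_rw [fourierCoeffOn_zero_one] at this
    exact this.congr fun n => (hG n).symm
  have h := has_pointwise_sum_fourier_series_of_summable hs (x : AddCircle (1 : ℝ))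
  refine h.congr_fun fun n => ?_
  rw [hG, smul_eq_mul, fourier_coe_apply]
  simp

/-- The functions on the upper half-plane that are real analytic. -/
abbrev IsRealAnalytic {V : Type*} [NormedAddCommGroup V] [NormedSpace ℂ V] (f : ℍ → V) : Prop :=
  AnalyticOnNhd ℝ (fun z : ℂ => f (ofComplex z)) {z | 0 < z.im}

theorem T_smul_coe (τ : ℍ) : ((Mp2Z.T.mat • τ : ℍ) : ℂ) = τ + 1 := by
  rw [show Mp2Z.T.mat = ModularGroup.T from rfl, modular_T_smul]; simp [add_comm]

theorem T_smul_ofComplex {z : ℂ} (hz : 0 < z.im) :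
    Mp2Z.T.mat • ofComplex z = ofComplex (z + 1) := by
  ext
  rw [T_smul_coe, ofComplex_apply_of_im_pos hz, ofComplex_apply_of_im_pos (by simpa using hz)]

theorem analyticAt_ofReal_add (w : ℂ) (x : ℝ) : AnalyticAt ℝ (fun x : ℝ => (x : ℂ) + w) x :=
  (ofRealCLM.analyticAt x).add analyticAt_const

theorem hasSum_fourierC {f : ℍ → ℂ} (hf : IsRealAnalytic f)
    (hT : ∀ τ, f (Mp2Z.T.mat • τ) = f τ) (τ : ℍ) :
    HasSum (fun n : ℤ => fourierC f n τ.im * cexp (2 * Real.pi * I * n * τ)) (f τ) := by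
  set y : ℝ := τ.im with hy
  have hy0 : 0 < y := τ.im_pos
  have him (x : ℝ) : 0 < ((x : ℂ) + y * I).im := by simpa using hy0
  let g : ℝ → ℂ := fun x => f (ofComplex (x + y * I))
  have hg : ContDiff ℝ 2 g := contDiff_iff_contDiffAt.mpr fun x =>
    (AnalyticAt.fun_comp (f := fun x : ℝ => (x : ℂ) + y * I) (x := x) (hf _ (him x))
      (analyticAt_ofReal_add (y * I) x)).contDiffAt
  have hp : Function.Periodic g 1 := fun x => by
    simp only [g]
    rw [← hT (ofComplex (x + y * I)), T_smul_ofComplex (him x)]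
    congr 2; push_cast; ring
  have hτ : (τ : ℂ) = τ.re + y * I := by rw [hy]; exact (re_add_im (τ : ℂ)).symm
  have h := hasSum_fourier_of_contDiff hg hp τ.re
  have hgτ : g τ.re = f τ := by simp only [g]; rw [← hτ, ofComplex_apply]
  rw [hgτ] at h
  refine h.congr_fun fun n => ?_
  -- `c_n(y)` differs from the ordinary Fourier coefficient of `x ↦ f(x + iy)` by a factor that
  -- cancels the `y`-dependence of `q^n`.
  have : fourierC f n y = (∫ t in (0 : ℝ)..1, g t * cexp (-(2 * Real.pi * I * n * t))) *
      cexp (-(2 * Real.pi * I * n * (y * I))) := by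
    rw [fourierC, ← intervalIntegral.integral_mul_const]
    refine intervalIntegral.integral_congr fun t _ => ?_
    simp only [g]
    rw [mul_assoc (f _), ← Complex.exp_add]
    congr 2; ring
  rw [this, mul_assoc, ← Complex.exp_add, hτ]
  congr 2; ring

/-! ### The components `f_r` -/

theorem I_zpow_eq_iff (n m : ℤ) : I ^ n = I ^ m ↔ (n : ZMod 4) = m := by
  have h := isPrimitiveRoot_I.zpow_eq_one_iff_dvd (n - m)
  rw [zpow_sub₀ I_ne_zero, div_eq_one_iff_eq (zpow_ne_zero _ I_ne_zero)] at h
  rw [h, ← sub_eq_zero, ← Int.cast_sub, ZMod.intCast_zmod_eq_zero_iff_dvd]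

theorem I_zpow_eq_val_iff (n : ℤ) (r : ZMod 4) : I ^ n = I ^ (r.val : ℤ) ↔ (n : ZMod 4) = r := by
  rw [I_zpow_eq_iff]; simp

theorem sum_I_zpow (a : ℤ) :
    ∑ m ∈ Finset.range 4, (I ^ a) ^ m = if (a : ZMod 4) = 0 then 4 else 0 := by
  have h4 : (I ^ a) ^ 4 = 1 := by
    rw [← zpow_natCast, ← _root_.zpow_mul, mul_comm, _root_.zpow_mul]; simp
  have h := I_zpow_eq_iff a 0
  rw [zpow_zero, Int.cast_zero] at h
  split_ifs with h0
  · rw [h.mpr h0]; simp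
  · have h1 : I ^ a ≠ 1 := fun h1 => h0 (h.mp h1)
    rw [geom_sum_eq h1, h4, sub_self, zero_div]

theorem T_zpow_smul_coe (n : ℤ) (τ : ℍ) : (((Mp2Z.T ^ n).mat • τ : ℍ) : ℂ) = τ + n := by
  rw [T_zpow_mat, modular_T_zpow_smul]; simp [add_comm]

theorem exp_quarter_translate (n m : ℤ) (z : ℂ) :
    cexp (2 * Real.pi * I * n * ((z + m) / 4)) =
      (I ^ n) ^ m * cexp (2 * Real.pi * I * n * z / 4) := by
  have : (2 * Real.pi * I * n * ((z + m) / 4) : ℂ) =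
      ((n * m : ℤ) : ℂ) * (Real.pi / 2 * I) + 2 * Real.pi * I * n * z / 4 := by push_cast; ring
  rw [this, Complex.exp_add, Complex.exp_int_mul, exp_pi_div_two_mul_I, _root_.zpow_mul]

theorem hasSum_quarter_translate {f : ℍ → ℂ} (hf : IsRealAnalytic f)
    (hT : ∀ τ, f (Mp2Z.T.mat • τ) = f τ) (m : ℤ) (τ : ℍ) :
    HasSum (fun n : ℤ => (I ^ n) ^ m * (fourierC f n (τ.im / 4) * cexp (2 * Real.pi * I * n * τ / 4)))
      (f (quarter ((Mp2Z.T ^ m).mat • τ))) := by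
  refine (hasSum_fourierC hf hT (quarter ((Mp2Z.T ^ m).mat • τ))).congr_fun fun n => ?_
  have him : (quarter ((Mp2Z.T ^ m).mat • τ)).im = τ.im / 4 := by
    rw [← UpperHalfPlane.coe_im, coe_quarter, T_zpow_smul_coe]; simp
  rw [him, coe_quarter, T_zpow_smul_coe, exp_quarter_translate]
  ring

theorem hasSum_quarter {f : ℍ → ℂ} (hf : IsRealAnalytic f)
    (hT : ∀ τ, f (Mp2Z.T.mat • τ) = f τ) (τ : ℍ) :
    HasSum (fun n : ℤ => fourierC f n (τ.im / 4) * cexp (2 * Real.pi * I * n * τ / 4))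
      (f (quarter τ)) := by
  simpa using hasSum_quarter_translate hf hT 0 τ

theorem summable_fourierPartTerm {f : ℍ → ℂ} (hf : IsRealAnalytic f)
    (hT : ∀ τ, f (Mp2Z.T.mat • τ) = f τ) (r : ZMod 4) (τ : ℍ) :
    Summable (fourierPartTerm f r τ) :=
  ((hasSum_quarter hf hT τ).summable.indicator {n : ℤ | (n : ZMod 4) = r}).congr fun n => by
    simp [fourierPartTerm, Set.indicator_apply]

/-- Fourier inversion on `ℤ/4`: `τ ↦ τ + m` multiplies the term of index `n` by `i^{nm}`. As a
finite combination of translates of `f(τ/4)`, the component `f_r` inherits analyticity and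
additivity in `f`. -/
theorem fourierPart_eq_sum {f : ℍ → ℂ} (hf : IsRealAnalytic f)
    (hT : ∀ τ, f (Mp2Z.T.mat • τ) = f τ) (r : ZMod 4) (τ : ℍ) :
    fourierPart f r τ = 4⁻¹ * ∑ m ∈ Finset.range 4,
      (I ^ (-(r.val : ℤ))) ^ m * f (quarter ((Mp2Z.T ^ (m : ℤ)).mat • τ)) := by
  have h := (hasSum_sum (s := Finset.range 4) fun m _ =>
    (hasSum_quarter_translate hf hT m τ).mul_left ((I ^ (-(r.val : ℤ))) ^ m)).mul_left (4⁻¹ : ℂ)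
  rw [fourierPart, ← h.tsum_eq]
  refine tsum_congr fun n => ?_
  set t := fourierC f n (τ.im / 4) * cexp (2 * Real.pi * I * n * τ / 4) with ht
  have h1 : ∀ m ∈ Finset.range 4, (I ^ (-(r.val : ℤ))) ^ m * ((I ^ n) ^ (m : ℤ) * t) =
      (I ^ (n - r.val)) ^ m * t := fun m _ => by
    rw [zpow_natCast, ← mul_assoc, ← mul_pow, ← zpow_add₀ I_ne_zero, neg_add_eq_sub]
  rw [Finset.sum_congr rfl h1, ← Finset.sum_mul, sum_I_zpow, fourierPartTerm]
  have h2 : ((n - r.val : ℤ) : ZMod 4) = 0 ↔ (n : ZMod 4) = r := by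
    rw [← sub_eq_zero (a := (n : ZMod 4))]; simp
  simp only [h2]
  split_ifs <;> simp [ht]

theorem fourierPart_T (f : ℍ → ℂ) (r : ZMod 4) (τ : ℍ) :
    fourierPart f r (Mp2Z.T.mat • τ) = I ^ (r.val : ℤ) * fourierPart f r τ := by
  rw [fourierPart, fourierPart, ← tsum_mul_left]
  refine tsum_congr fun n => ?_
  have him : (Mp2Z.T.mat • τ).im = τ.im := by
    rw [← UpperHalfPlane.coe_im, T_smul_coe]; simp
  have he := exp_quarter_translate n 1 τ
  rw [zpow_one, Int.cast_one, mul_div_assoc'] at he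
  unfold fourierPartTerm
  split_ifs with h
  · rw [him, T_smul_coe, he, (I_zpow_eq_val_iff n r).mpr h]; ring
  · rw [mul_zero]

theorem sign_cast_ne_zero (ε : ℤˣ) : (0 : ZMod 4) ≠ ((ε : ℤ) : ZMod 4) := by
  rcases Int.units_eq_one_or ε with rfl | rfl <;> decide

theorem I_zpow_val_sign (ε : ℤˣ) : I ^ ((((ε : ℤ) : ZMod 4)).val : ℤ) = I ^ (ε : ℤ) :=
  ((I_zpow_eq_val_iff _ _).mpr rfl).symm

theorem lift_T (ε : ℤˣ) (f : ℍ → ℂ) (τ : ℍ) :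
    lift ε f (Mp2Z.T.mat • τ) = vectorRep ε Mp2Z.T (lift ε f τ) := by
  rw [vectorRep_T, lift, lift, fourierPart_T, fourierPart_T, I_zpow_val_sign]
  simp

/-- The expansion at infinity is supported on the integers that are `0` or `ε` modulo `4`. -/
def IsPlus (ε : ℤˣ) (f : ℍ → ℂ) : Prop :=
  ∀ n : ℤ, ¬((n : ZMod 4) = 0 ∨ (n : ZMod 4) = ((ε : ℤ) : ZMod 4)) →
    ∀ y : ℝ, 0 < y → fourierC f n y = 0

/-- The classes `0` and `ε` are distinct modulo `4`, so each nonzero term of the expansion of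
`f(τ/4)` occurs in exactly one of the two series. -/
theorem lift_sum {ε : ℤˣ} {f : ℍ → ℂ} (hf : IsRealAnalytic f)
    (hT : ∀ τ, f (Mp2Z.T.mat • τ) = f τ) (hplus : IsPlus ε f) (τ : ℍ) :
    lift ε f τ 0 + lift ε f τ 1 = f (quarter τ) := by
  simp only [lift, Matrix.cons_val_zero, Matrix.cons_val_one]
  rw [fourierPart, fourierPart, ← Summable.tsum_add (summable_fourierPartTerm hf hT _ τ)
    (summable_fourierPartTerm hf hT _ τ), ← (hasSum_quarter hf hT τ).tsum_eq]
  refine tsum_congr fun n => ?_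
  unfold fourierPartTerm
  have h0 := sign_cast_ne_zero ε
  by_cases h1 : (n : ZMod 4) = 0
  · rw [if_pos h1, if_neg (h1 ▸ h0), add_zero]
  · by_cases h2 : (n : ZMod 4) = ((ε : ℤ) : ZMod 4)
    · rw [if_neg h1, if_pos h2, zero_add]
    · rw [if_neg h1, if_neg h2, hplus n (by tauto) _ (by have := τ.im_pos; positivity)]
      simp

theorem IsRealAnalytic.comp_affine {V : Type*} [NormedAddCommGroup V] [NormedSpace ℂ V]
    {f : ℍ → V} (hf : IsRealAnalytic f) {s : ℍ → ℍ} (a b : ℂ)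
    (hs : ∀ τ, (s τ : ℂ) = a * τ + b) : IsRealAnalytic fun τ => f (s τ) := by
  have him : ∀ z : ℂ, 0 < z.im → a * z + b = s (ofComplex z) := fun z hz => by
    rw [hs, ofComplex_apply_of_im_pos hz]
  have hmap : Set.MapsTo (fun z : ℂ => a * z + b) {z | 0 < z.im} {z | 0 < z.im} := fun z hz => by
    change 0 < (a * z + b).im
    rw [him z hz]; exact (s _).im_pos
  have hlin : AnalyticOnNhd ℝ (fun z : ℂ => a * z + b) {z | 0 < z.im} := fun z _ =>
    (analyticAt_const.mul analyticAt_id).add analyticAt_const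
  refine (AnalyticOnNhd.comp hf hlin hmap).congr (isOpen_lt continuous_const continuous_im) ?_
  intro z hz
  simp only [Function.comp_apply]
  rw [him z hz, ofComplex_apply]

theorem isRealAnalytic_fourierPart {f : ℍ → ℂ} (hf : IsRealAnalytic f)
    (hT : ∀ τ, f (Mp2Z.T.mat • τ) = f τ) (r : ZMod 4) : IsRealAnalytic (fourierPart f r) := by
  rw [show fourierPart f r = _ from funext (fourierPart_eq_sum hf hT r)]
  refine analyticOnNhd_const.mul (Finset.analyticOnNhd_fun_sum _ fun m _ => ?_)
  refine analyticOnNhd_const.mul (hf.comp_affine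
    (s := fun τ => quarter ((Mp2Z.T ^ (m : ℤ)).mat • τ)) (1 / 4) (m / 4) fun τ => ?_)
  rw [coe_quarter, T_zpow_smul_coe]
  push_cast; ring

theorem isRealAnalytic_lift {f : ℍ → ℂ} (hf : IsRealAnalytic f)
    (hT : ∀ τ, f (Mp2Z.T.mat • τ) = f τ) (ε : ℤˣ) : IsRealAnalytic (lift ε f) := by
  refine AnalyticOnNhd.pi fun i => ?_
  fin_cases i
  · exact isRealAnalytic_fourierPart hf hT 0
  · exact isRealAnalytic_fourierPart hf hT _

/-! ### The inverse map -/

/-- The function `F₀(4 τ) + F_ε(4 τ)`. -/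
def descend (F : ℍ → Fin 2 → ℂ) (τ : ℍ) : ℂ := F (fourTimes τ) 0 + F (fourTimes τ) 1

theorem isRealAnalytic_entry {F : ℍ → Fin 2 → ℂ} (hF : IsRealAnalytic F) (i : Fin 2) :
    IsRealAnalytic fun τ => F (fourTimes τ) i :=
  IsRealAnalytic.comp_affine (f := fun τ => F τ i) (analyticOnNhd_pi_iff.mp hF i) 4 0
    fun τ => by simp

theorem isRealAnalytic_descend {F : ℍ → Fin 2 → ℂ} (hF : IsRealAnalytic F) :
    IsRealAnalytic (descend F) :=
  (isRealAnalytic_entry hF 0).add (isRealAnalytic_entry hF 1)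

/-- Shifting by `1/4` multiplies the integrand by `i^{a-n} ≠ 1` but leaves the integral over a
period unchanged. -/
theorem fourierC_eq_zero_of_translate {f : ℍ → ℂ} {a n : ℤ}
    (hf : ∀ z : ℂ, 0 < z.im → f (ofComplex (z + 1 / 4)) = I ^ a * f (ofComplex z))
    (hn : (n : ZMod 4) ≠ a) {y : ℝ} (hy : 0 < y) : fourierC f n y = 0 := by
  let H : ℝ → ℂ := fun x =>
    f (ofComplex (x + y * I)) * cexp (-(2 * Real.pi * I * n * (x + y * I)))
  have hH (x : ℝ) : H (x + 1 / 4) = I ^ (a - n) * H x := by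
    have h1 : (((x + 1 / 4 : ℝ) : ℂ) + y * I) = (x + y * I) + 1 / 4 := by push_cast; ring
    have h2 : cexp (-(2 * Real.pi * I * n * ((x + y * I) + 1 / 4))) =
        I ^ (-n) * cexp (-(2 * Real.pi * I * n * (x + y * I))) := by
      rw [show I ^ (-n) = cexp (((-n : ℤ) : ℂ) * (Real.pi / 2 * I)) by
        rw [Complex.exp_int_mul, exp_pi_div_two_mul_I], ← Complex.exp_add]
      congr 1; push_cast; ring
    simp only [H]
    rw [h1, hf _ (by simpa using hy), h2, sub_eq_add_neg, zpow_add₀ I_ne_zero]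
    ring
  have hp : Function.Periodic H 1 := fun x => by
    rw [show x + 1 = x + 1 / 4 + 1 / 4 + 1 / 4 + 1 / 4 by ring, hH, hH, hH, hH, ← mul_assoc,
      ← mul_assoc, ← mul_assoc, ← zpow_add₀ I_ne_zero, ← zpow_add₀ I_ne_zero,
      ← zpow_add₀ I_ne_zero, show a - n + (a - n) + (a - n) + (a - n) = 4 * (a - n) by ring,
      _root_.zpow_mul]
    simp
  have h1 : (∫ x in (0 : ℝ)..1, H (x + 1 / 4)) = ∫ x in (0 : ℝ)..1, H x := by
    rw [intervalIntegral.integral_comp_add_right]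
    have := hp.intervalIntegral_add_eq (1 / 4) 0
    rw [zero_add] at this
    rw [zero_add, add_comm 1, this]
  simp only [hH] at h1
  rw [intervalIntegral.integral_const_mul] at h1
  have h2 : I ^ (a - n) ≠ 1 := fun h => hn (by
    rw [← zpow_zero I, I_zpow_eq_iff] at h
    rw [Int.cast_sub, Int.cast_zero, sub_eq_zero] at h
    exact h.symm)
  have h3 : (I ^ (a - n) - 1) * (∫ x in (0 : ℝ)..1, H x) = 0 := by
    rw [sub_mul, h1, one_mul, sub_self]
  exact (mul_eq_zero.mp h3).resolve_left (sub_ne_zero.mpr h2)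

theorem fourTimes_ofComplex_translate {z : ℂ} (hz : 0 < z.im) :
    fourTimes (ofComplex (z + 1 / 4)) = Mp2Z.T.mat • fourTimes (ofComplex z) := by
  ext
  rw [T_smul_coe, coe_fourTimes, coe_fourTimes, ofComplex_apply_of_im_pos hz,
    ofComplex_apply_of_im_pos (by simpa using hz)]
  ring

theorem isPlus_descend {ε : ℤˣ} {F : ℍ → Fin 2 → ℂ} (hF : IsRealAnalytic F)
    (hT : ∀ τ, F (Mp2Z.T.mat • τ) = vectorRep ε Mp2Z.T (F τ)) : IsPlus ε (descend F) := by
  intro n hn y hy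
  rw [not_or] at hn
  have h0 : fourierC (fun τ => F (fourTimes τ) 0) n y = 0 :=
    fourierC_eq_zero_of_translate (a := 0) (fun z hz => by
      rw [fourTimes_ofComplex_translate hz, hT, vectorRep_T]; simp) (by simpa using hn.1) hy
  have h1 : fourierC (fun τ => F (fourTimes τ) 1) n y = 0 :=
    fourierC_eq_zero_of_translate (a := ε) (fun z hz => by
      rw [fourTimes_ofComplex_translate hz, hT, vectorRep_T]; simp) hn.2 hy
  have h := fourierC_add (f := fun τ => F (fourTimes τ) 0)
    (g := fun τ => F (fourTimes τ) 1) (isRealAnalytic_entry hF 0) (isRealAnalytic_entry hF 1) n hy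
  rw [h0, h1, add_zero] at h
  exact h

theorem descend_T {ε : ℤˣ} {F : ℍ → Fin 2 → ℂ}
    (hT : ∀ τ, F (Mp2Z.T.mat • τ) = vectorRep ε Mp2Z.T (F τ)) (τ : ℍ) :
    descend F (Mp2Z.T.mat • τ) = descend F τ := by
  have h : fourTimes (Mp2Z.T.mat • τ) = (Mp2Z.T ^ (4 : ℤ)).mat • fourTimes τ := by
    ext
    rw [coe_fourTimes, T_smul_coe, T_zpow_smul_coe, coe_fourTimes]; push_cast; ring
  have h4 : (I ^ (ε : ℤ)) ^ (4 : ℤ) = 1 := by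
    rw [← _root_.zpow_mul, mul_comm, _root_.zpow_mul]; simp
  simp only [descend]
  rw [h, T_zpow_equivariant hT, vectorRep_T_zpow, h4]
  simp

theorem descend_quarter (F : ℍ → Fin 2 → ℂ) (τ : ℍ) : descend F (quarter τ) = F τ 0 + F τ 1 := by
  simp [descend]

/-- The entries of `F` are eigenfunctions of `T` with eigenvalues `1` and `i^ε`, so the averages
over four translates separate them. -/
theorem lift_descend {ε : ℤˣ} {F : ℍ → Fin 2 → ℂ} (hF : IsRealAnalytic F)
    (hT : ∀ τ, F (Mp2Z.T.mat • τ) = vectorRep ε Mp2Z.T (F τ)) : lift ε (descend F) = F := by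
  have h0 := sign_cast_ne_zero ε
  have key (r : ZMod 4) (τ : ℍ) : fourierPart (descend F) r τ =
      (if 0 = r then F τ 0 else 0) + if ((ε : ℤ) : ZMod 4) = r then F τ 1 else 0 := by
    rw [fourierPart_eq_sum (isRealAnalytic_descend hF) (descend_T hT)]
    have h1 : ∀ m ∈ Finset.range 4,
        (I ^ (-(r.val : ℤ))) ^ m * descend F (quarter ((Mp2Z.T ^ (m : ℤ)).mat • τ)) =
        (I ^ (0 - r.val : ℤ)) ^ m * F τ 0 + (I ^ (ε - r.val : ℤ)) ^ m * F τ 1 := fun m _ => by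
      rw [descend_quarter, T_zpow_equivariant hT, vectorRep_T_zpow, zero_sub,
        sub_eq_neg_add (ε : ℤ), zpow_add₀ I_ne_zero, mul_pow, zpow_natCast]
      simp; ring
    rw [Finset.sum_congr rfl h1, Finset.sum_add_distrib, ← Finset.sum_mul, ← Finset.sum_mul,
      sum_I_zpow, sum_I_zpow]
    have h2 (a : ℤ) : ((a - r.val : ℤ) : ZMod 4) = 0 ↔ (a : ZMod 4) = r := by
      rw [← sub_eq_zero (a := (a : ZMod 4))]; simp
    simp only [h2, Int.cast_zero]
    split_ifs <;> ring
  funext τ i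
  fin_cases i
  · simp [lift, key, h0.symm]
  · simp [lift, key, h0]

/-! ### Automorphy of the lift and of the inverse map -/

theorem lift_transform {Γ : Subgroup Mp2Z} (hTΓ : Mp2Z.T ∈ Γ) {m : ℤ} {ε : ℤˣ}
    {μ : Mp2Z → ℂ} (hμ : ∀ A ∈ Γ, ∀ n n' : ℤ, μ (Mp2Z.T ^ n * A * Mp2Z.T ^ n') = μ A)
    {f : ℍ → ℂ} (hf : IsRealAnalytic f) (hT : ∀ τ, f (Mp2Z.T.mat • τ) = f τ)
    (hplus : IsPlus ε f)
    (h : ∀ A B, IsFourConj A B → B ∈ Γ → ∀ τ, f (A.mat • τ) =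
      A.phi τ ^ m * (psi A ^ (ε : ℤ) * μ B * f τ))
    {A : Mp2Z} (hA : A ∈ Γ) (τ : ℍ) :
    lift ε f (A.mat • τ) = A.phi τ ^ m • (μ A • vectorRep ε A (lift ε f τ)) := by
  refine transform_of_sum_transform hTΓ hμ (lift_T ε f) (fun A B hAB hB τ => ?_) hA τ
  obtain ⟨σ, rfl⟩ : ∃ σ, τ = fourTimes σ := ⟨quarter τ, by simp⟩
  rw [lift_sum hf hT hplus, lift_sum hf hT hplus, ← hAB.fourTimes_smul, quarter_fourTimes,
    quarter_fourTimes, h A B hAB hB, hAB.phi]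

theorem descend_transform {m : ℤ} {ε : ℤˣ} {x : ℂ} {F : ℍ → Fin 2 → ℂ} {A B : Mp2Z}
    (hAB : IsFourConj A B)
    (h : ∀ τ, F (B.mat • τ) = B.phi τ ^ m • (x • vectorRep ε B (F τ))) (τ : ℍ) :
    descend F (A.mat • τ) = A.phi τ ^ m * (psi A ^ (ε : ℤ) * x * descend F τ) := by
  have h1 := hAB.vectorRep_sum ε (F (fourTimes τ))
  simp only [descend]
  rw [hAB.fourTimes_smul, h, hAB.phi]
  simp only [Pi.smul_apply, smul_eq_mul]
  linear_combination B.phi (fourTimes τ) ^ m * x * h1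

/-! ### Congruence subgroups -/

theorem mem_Gamma0t {N : ℕ} {A : Mp2Z} : A ∈ Gamma0t N ↔ (N : ℤ) ∣ A.mat 1 0 := by
  rw [← ZMod.intCast_zmod_eq_zero_iff_dvd]
  exact CongruenceSubgroup.Gamma0_mem

theorem mem_Gamma1t {N : ℕ} {A : Mp2Z} : A ∈ Gamma1t N ↔
    ((A.mat 0 0 : ℤ) : ZMod N) = 1 ∧ ((A.mat 1 1 : ℤ) : ZMod N) = 1 ∧
      ((A.mat 1 0 : ℤ) : ZMod N) = 0 :=
  CongruenceSubgroup.Gamma1_mem N A.mat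

theorem Gamma1t_le_Gamma0t (N : ℕ) : Gamma1t N ≤ Gamma0t N := fun A hA => by
  rw [mem_Gamma0t, ← ZMod.intCast_zmod_eq_zero_iff_dvd]
  exact (mem_Gamma1t.mp hA).2.2

theorem T_mem_Gamma1t (N : ℕ) : Mp2Z.T ∈ Gamma1t N := by
  rw [mem_Gamma1t]; simp [Mp2Z.T, ModularGroup.T]

theorem T_mem_Gamma0t (N : ℕ) : Mp2Z.T ∈ Gamma0t N := Gamma1t_le_Gamma0t N (T_mem_Gamma1t N)

theorem IsFourConj.mem_Gamma0t_iff {A B : Mp2Z} (h : IsFourConj A B) (N : ℕ) :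
    A ∈ Gamma0t (4 * N) ↔ B ∈ Gamma0t N := by
  rw [mem_Gamma0t, mem_Gamma0t, h.c]
  push_cast
  exact mul_dvd_mul_iff_left four_ne_zero

/-- Since `c` is divided by `4` under conjugation, the condition modulo `4N` on `A` becomes one
modulo `N` on `B`, while the diagonal entries are kept. -/
theorem IsFourConj.mem_GammaNt_iff {A B : Mp2Z} (h : IsFourConj A B) (N : ℕ) :
    A ∈ GammaNt N ↔ B ∈ Gamma1t N := by
  rw [GammaNt, Subgroup.mem_inf, h.mem_Gamma0t_iff]
  refine ⟨fun ⟨h0, h1⟩ => ?_, fun h1 => ⟨Gamma1t_le_Gamma0t N h1, ?_⟩⟩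
  · rw [mem_Gamma0t, ← ZMod.intCast_zmod_eq_zero_iff_dvd] at h0
    rw [mem_Gamma1t] at h1 ⊢
    exact ⟨h.a ▸ h1.1, h.d ▸ h1.2.1, h0⟩
  · rw [mem_Gamma1t] at h1 ⊢
    refine ⟨h.a ▸ h1.1, h.d ▸ h1.2.1, ?_⟩
    rw [h.c, Int.cast_mul, h1.2.2, mul_zero]

theorem exists_isFourConj {N : ℕ} {A : Mp2Z} (hA : A ∈ Gamma0t (4 * N)) : ∃ B, IsFourConj A B := by
  rw [mem_Gamma0t] at hA
  push_cast at hA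
  exact exists_isFourConj_of_lower (dvd_of_mul_right_dvd hA)

theorem charVal_T_zpow_mul_mul {N : ℕ} (χ : DirichletCharacter ℂ N) {A : Mp2Z}
    (hA : A ∈ Gamma0t N) (n n' : ℤ) :
    charVal χ (Mp2Z.T ^ n * A * Mp2Z.T ^ n') = charVal χ A := by
  rw [mem_Gamma0t, ← ZMod.intCast_zmod_eq_zero_iff_dvd] at hA
  rw [charVal, charVal, (T_zpow_mul_mul_T_zpow_mat A n n').2.2, Int.cast_add, Int.cast_mul, hA,
    mul_zero, add_zero]

theorem charVal_of_mem_Gamma1t {N : ℕ} (χ : DirichletCharacter ℂ N) {A : Mp2Z}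
    (hA : A ∈ Gamma1t N) : charVal χ A = 1 := by
  rw [charVal, (mem_Gamma1t.mp hA).2.1, map_one]

/-! ### The characters -/

theorem psi_T : psi Mp2Z.T = 1 := by
  have : rootSign Mp2Z.T = 1 :=
    rootSign_eq_of_phi UpperHalfPlane.I (by simp [Mp2Z.T, j, ModularGroup.T])
  rw [psi_eq, this]
  simp [Mp2Z.T, ModularGroup.T, quadSymbol, epsSymbol]

/-- As `ψ⁴ = 1`, only `2k + ξ` modulo `4` matters; for odd `k` it is `2 + ξ ≡ -ξ`. -/
theorem psi_zpow_weight {k : ℕ} {ξ ε : ℤˣ} (hε : ε = (-1) ^ k * ξ) (A : Mp2Z) :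
    psi A ^ (2 * (k : ℤ) + (ξ : ℤ)) = psi A ^ (ε : ℤ) := by
  refine psi_zpow_eq A ?_
  rcases Nat.even_or_odd k with hk | hk
  · rw [hε, hk.neg_one_pow, one_mul]
    obtain ⟨r, rfl⟩ := hk
    exact ⟨r, by push_cast; ring⟩
  · rw [hε, hk.neg_one_pow]
    obtain ⟨r, rfl⟩ := hk
    rcases Int.units_eq_one_or ξ with rfl | rfl
    · exact ⟨r + 1, by push_cast; ring⟩
    · exact ⟨r, by push_cast; ring⟩

theorem charVal_changeLevel {N M : ℕ} (h : N ∣ M) (χ : DirichletCharacter ℂ N) {A : Mp2Z}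
    (hA : A ∈ Gamma0t M) :
    DirichletCharacter.changeLevel h χ ((A.mat 1 1 : ℤ) : ZMod M) = charVal χ A := by
  rw [mem_Gamma0t, ← ZMod.intCast_zmod_eq_zero_iff_dvd] at hA
  -- The induced character agrees with `χ` only on units; here `a d ≡ 1` because `M ∣ c`.
  have hu : IsUnit ((A.mat 1 1 : ℤ) : ZMod M) := by
    refine IsUnit.of_mul_eq_one ((A.mat 0 0 : ℤ) : ZMod M) ?_
    have := congrArg (Int.cast : ℤ → ZMod M) (det_eq_one A.mat)
    push_cast at this
    rw [hA] at this
    linear_combination this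
  obtain ⟨u, hu⟩ := hu
  rw [← hu, DirichletCharacter.changeLevel_eq_cast_of_dvd, hu, ZMod.cast_intCast h, charVal]

theorem chi_four_eq_psi_sq {A : Mp2Z} (hA : 4 ∣ A.mat 1 0) :
    ((ZMod.χ₄ ((A.mat 1 1 : ℤ) : ZMod 4) : ℤ) : ℂ) = psi A ^ 2 := by
  have h := Int.odd_iff.mp (lower_right_odd hA)
  rw [psi_sq]
  split_ifs with h1
  · rw [ZMod.χ₄_int_one_mod_four h1]; simp
  · rw [ZMod.χ₄_int_three_mod_four (by omega)]; simp

theorem psi_zpow_mul_charVal_omegaChar {N k : ℕ} {ξ ε : ℤˣ} (hε : ε = (-1) ^ k * ξ)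
    {χ : DirichletCharacter ℂ N} (hχ : χ (-1) = ((ξ : ℤ) : ℂ)) {A : Mp2Z}
    (hA : A ∈ Gamma0t (4 * N)) :
    psi A ^ (2 * (k : ℤ) + 1) * charVal (omegaChar χ) A = psi A ^ (ε : ℤ) * charVal χ A := by
  have hA4 : 4 ∣ A.mat 1 0 := by
    rw [mem_Gamma0t] at hA; push_cast at hA; exact dvd_of_mul_right_dvd hA
  rw [← psi_zpow_weight hε, charVal, omegaChar, MulChar.mul_apply, charVal_changeLevel _ χ hA,
    ← mul_assoc]
  congr 1
  rcases Int.units_eq_one_or ξ with rfl | rfl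
  · have h1 : χ (-1) = 1 := by simpa using hχ
    -- For `ξ = 1` the extra factor is the trivial character modulo `4N`, evaluated at a unit by
    -- regarding it as induced from modulus `1`.
    have hu := charVal_changeLevel (one_dvd (4 * N)) (1 : DirichletCharacter ℂ 1) hA
    rw [map_one] at hu
    rw [if_pos h1, hu, charVal, Subsingleton.elim ((A.mat 1 1 : ℤ) : ZMod 1) 1, map_one, mul_one]
    simp
  · have h1 : χ (-1) ≠ 1 := by rw [hχ]; norm_num
    rw [if_neg h1, charVal_changeLevel _ _ hA, charVal, MulChar.ringHomComp_apply]
    simp only [Int.coe_castRingHom]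
    -- For `ξ = -1` the extra factor is `ψ²`, and `2k + 3 ≡ 2k - 1 (mod 4)`.
    rw [chi_four_eq_psi_sq hA4, ← zpow_ofNat, ← zpow_add₀ (psi_ne_zero A)]
    exact psi_zpow_eq A ⟨1, by push_cast; ring⟩

/-! ### The plus-space -/

theorem isPlus_iff {k : ℕ} {ξ ε : ℤˣ} (hε : ε = (-1) ^ k * ξ) (f : ℍ → ℂ) :
    IsPlus ε f ↔ ∀ n : ℤ, ¬ ((((-1) ^ k * (ξ : ℤ) * n : ℤ) : ZMod 4) = 0 ∨
      (((-1) ^ k * (ξ : ℤ) * n : ℤ) : ZMod 4) = 1) → ∀ y : ℝ, 0 < y → fourierC f n y = 0 := by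
  have h : ((-1) ^ k * (ξ : ℤ) : ℤ) = (ε : ℤ) := by rw [hε]; push_cast; rfl
  rw [h, IsPlus]
  refine forall_congr' fun n => imp_congr_left (not_congr ?_)
  rcases Int.units_eq_one_or ε with rfl | rfl
  · simp
  · simp [neg_eq_iff_eq_neg]

theorem mem_plusSpace_iff {N k : ℕ} {ξ ε : ℤˣ} (hε : ε = (-1) ^ k * ξ) (f : ℍ → ℂ) :
    f ∈ plusSpace N k ξ ↔ IsRealAnalytic f ∧ (∀ A ∈ GammaNt N, ∀ τ, f (A.mat • τ) =
      A.phi τ ^ (2 * k + 1 : ℤ) * (psi A ^ (ε : ℤ) * f τ)) ∧ IsPlus ε f := by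
  rw [isPlus_iff hε, ← and_assoc]
  refine and_congr (and_congr Iff.rfl ?_) Iff.rfl
  simp [scalarRep, psi_zpow_weight hε]

theorem T_invariant_of_mem_plusSpace {N k : ℕ} {ξ : ℤˣ} {f : ℍ → ℂ}
    (hf : f ∈ plusSpace N k ξ) (τ : ℍ) : f (Mp2Z.T.mat • τ) = f τ := by
  have h := ((mem_plusSpace_iff rfl f).mp hf).2.1 Mp2Z.T
    ⟨T_mem_Gamma0t _, T_mem_Gamma1t _⟩ τ
  rw [h, psi_T]
  simp [Mp2Z.T]

theorem lift_mem {N k : ℕ} {ξ ε : ℤˣ} (hε : ε = (-1) ^ k * ξ) {f : ℍ → ℂ}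
    (hf : f ∈ plusSpace N k ξ) :
    lift ε f ∈ autForms (2 * k + 1) (Gamma1t N) (vectorRep ε) := by
  obtain ⟨h1, h2, h3⟩ := (mem_plusSpace_iff hε f).mp hf
  have hT := T_invariant_of_mem_plusSpace hf
  refine ⟨isRealAnalytic_lift h1 hT ε, fun A hA τ => ?_⟩
  have := lift_transform (m := 2 * k + 1) (T_mem_Gamma1t N) (μ := fun _ => 1) (fun _ _ _ _ => rfl)
    h1 hT h3 (fun A B hAB hB τ => by
      rw [h2 A ((hAB.mem_GammaNt_iff N).mpr hB), mul_one]) hA τ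
  rwa [one_smul] at this

theorem T_equivariant_of_mem {N : ℕ} {m : ℤ} {ε : ℤˣ} {F : ℍ → Fin 2 → ℂ}
    (hF : F ∈ autForms m (Gamma1t N) (vectorRep ε)) (τ : ℍ) :
    F (Mp2Z.T.mat • τ) = vectorRep ε Mp2Z.T (F τ) := by
  rw [hF.2 _ (T_mem_Gamma1t N)]
  simp [Mp2Z.T]

theorem descend_mem {N k : ℕ} {ξ ε : ℤˣ} (hε : ε = (-1) ^ k * ξ) {F : ℍ → Fin 2 → ℂ}
    (hF : F ∈ autForms (2 * k + 1) (Gamma1t N) (vectorRep ε)) :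
    descend F ∈ plusSpace N k ξ := by
  refine (mem_plusSpace_iff hε _).mpr ⟨isRealAnalytic_descend hF.1, fun A hA τ => ?_,
    isPlus_descend hF.1 (T_equivariant_of_mem hF)⟩
  obtain ⟨B, hAB⟩ := exists_isFourConj hA.1
  have := descend_transform (m := 2 * k + 1) (ε := ε) (x := 1) (F := F) hAB (fun σ => by
    rw [hF.2 B ((hAB.mem_GammaNt_iff N).mp hA), one_smul]) τ
  rwa [mul_one] at this

/-! ### Linearity and bijectivity of the lift, and its restriction to characters. -/

theorem lift_add (ε : ℤˣ) {f g : ℍ → ℂ} (hf : IsRealAnalytic f) (hg : IsRealAnalytic g)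
    (hfT : ∀ τ, f (Mp2Z.T.mat • τ) = f τ) (hgT : ∀ τ, g (Mp2Z.T.mat • τ) = g τ) :
    lift ε (f + g) = lift ε f + lift ε g := by
  have key (r : ZMod 4) (τ : ℍ) :
      fourierPart (f + g) r τ = fourierPart f r τ + fourierPart g r τ := by
    rw [fourierPart_eq_sum hf hfT, fourierPart_eq_sum hg hgT,
      fourierPart_eq_sum (hf.add hg) fun τ => by rw [Pi.add_apply, hfT, hgT, Pi.add_apply]]
    simp only [Pi.add_apply, mul_add, Finset.sum_add_distrib]
  funext τ i
  fin_cases i <;> simp [lift, key]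

theorem lift_smul (ε : ℤˣ) (c : ℂ) (f : ℍ → ℂ) : lift ε (c • f) = c • lift ε f := by
  have key (r : ZMod 4) (τ : ℍ) : fourierPart (c • f) r τ = c * fourierPart f r τ := by
    rw [fourierPart, fourierPart, ← tsum_mul_left]
    refine tsum_congr fun n => ?_
    unfold fourierPartTerm
    split_ifs
    · rw [fourierC_smul, mul_assoc]
    · rw [mul_zero]
  funext τ i
  fin_cases i <;> simp [lift, key]

/-- The map `f ↦ L_ε f` as a linear map. -/
def liftLinear (N k : ℕ) {ξ ε : ℤˣ} (hε : ε = (-1) ^ k * ξ) :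
    plusSpace N k ξ →ₗ[ℂ] autForms (2 * k + 1) (Gamma1t N) (vectorRep ε) where
  toFun f := ⟨lift ε f, lift_mem hε f.2⟩
  map_add' f g := Subtype.ext (lift_add ε f.2.1.1 g.2.1.1
    (T_invariant_of_mem_plusSpace f.2) (T_invariant_of_mem_plusSpace g.2))
  map_smul' c f := Subtype.ext (lift_smul ε c f)

theorem descend_lift {N k : ℕ} {ξ ε : ℤˣ} (hε : ε = (-1) ^ k * ξ) {f : ℍ → ℂ}
    (hf : f ∈ plusSpace N k ξ) : descend (lift ε f) = f := by
  obtain ⟨h1, -, h3⟩ := (mem_plusSpace_iff hε f).mp hf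
  funext τ
  rw [descend, lift_sum h1 (T_invariant_of_mem_plusSpace hf) h3, quarter_fourTimes]

theorem liftLinear_bijective (N k : ℕ) {ξ ε : ℤˣ} (hε : ε = (-1) ^ k * ξ) :
    Function.Bijective (liftLinear N k hε) := by
  refine ⟨fun f g h => Subtype.ext ?_, fun F => ⟨⟨descend F, descend_mem hε F.2⟩, Subtype.ext ?_⟩⟩
  · have h' : lift ε f = lift ε g := congrArg Subtype.val h
    rw [← descend_lift hε f.2, h', descend_lift hε g.2]
  · exact lift_descend F.2.1 (T_equivariant_of_mem F.2)

theorem lift_mem_char {N k : ℕ} {ξ ε : ℤˣ} (hε : ε = (-1) ^ k * ξ) {χ : DirichletCharacter ℂ N}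
    (hχ : χ (-1) = ((ξ : ℤ) : ℂ)) {f : ℍ → ℂ} (hf : f ∈ plusSpaceChar N k ξ χ) :
    lift ε f ∈ autForms (2 * k + 1) (Gamma0t N) (fun A => charVal χ A • vectorRep ε A) := by
  obtain ⟨hf0, hf⟩ := hf
  obtain ⟨h1, -, h3⟩ := (mem_plusSpace_iff hε f).mp hf
  have hT := T_invariant_of_mem_plusSpace hf
  refine ⟨isRealAnalytic_lift h1 hT ε, fun A hA τ => ?_⟩
  refine lift_transform (m := 2 * k + 1) (T_mem_Gamma0t N) (μ := charVal χ)
    (fun A hA n n' => charVal_T_zpow_mul_mul χ hA n n') h1 hT h3 (fun A B hAB hB τ => ?_) hA τ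
  have hA := (hAB.mem_Gamma0t_iff N).mpr hB
  have hd : charVal χ B = charVal χ A := by rw [charVal, charVal, hAB.d]
  rw [hf0.2 A hA, hd, ← psi_zpow_mul_charVal_omegaChar hε hχ hA]
  simp [scalarRep]

theorem descend_mem_char {N k : ℕ} {ξ ε : ℤˣ} (hε : ε = (-1) ^ k * ξ)
    {χ : DirichletCharacter ℂ N} (hχ : χ (-1) = ((ξ : ℤ) : ℂ)) {F : ℍ → Fin 2 → ℂ}
    (hF : F ∈ autForms (2 * k + 1) (Gamma0t N) (fun A => charVal χ A • vectorRep ε A)) :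
    F ∈ autForms (2 * k + 1) (Gamma1t N) (vectorRep ε) ∧ descend F ∈ plusSpaceChar N k ξ χ := by
  -- On the preimage of `Γ₁(N)` the character is trivial, so the result without character applies to
  -- `F`.
  have hF1 : F ∈ autForms (2 * k + 1) (Gamma1t N) (vectorRep ε) :=
    ⟨hF.1, fun A hA τ => by
      have h := hF.2 A (Gamma1t_le_Gamma0t N hA) τ
      beta_reduce at h
      rwa [charVal_of_mem_Gamma1t χ hA, one_smul] at h⟩
  refine ⟨hF1, ⟨isRealAnalytic_descend hF.1, fun A hA τ => ?_⟩, descend_mem hε hF1⟩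
  obtain ⟨B, hAB⟩ := exists_isFourConj hA
  have hd : charVal χ B = charVal χ A := by rw [charVal, charVal, hAB.d]
  rw [descend_transform (m := 2 * k + 1) (ε := ε) (x := charVal χ B) hAB
    (fun σ => hF.2 B ((hAB.mem_Gamma0t_iff N).mp hA) σ) τ, hd,
    ← psi_zpow_mul_charVal_omegaChar hε hχ hA]
  simp [scalarRep]

end HalfIntegral
end

/-! ### The theorem. -/

theorem mainTheorem5 (N k : ℕ) (hN : 0 < N) (hk : 0 < k) (ξ ε : ℤˣ) (hε : ε = (-1) ^ k * ξ) :
    (∀ f ∈ HalfIntegral.plusSpace N k ξ,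
      (∀ τ : UpperHalfPlane, HasSum (fun n : ℤ =>
        HalfIntegral.fourierC f n τ.im * Complex.exp (2 * Real.pi * Complex.I * n * τ)) (f τ)) ∧
      ∀ (r : ZMod 4) (τ : UpperHalfPlane), Summable (HalfIntegral.fourierPartTerm f r τ)) ∧
    (∃ L : HalfIntegral.plusSpace N k ξ ≃ₗ[ℂ]
        HalfIntegral.autForms (2 * k + 1) (HalfIntegral.Gamma1t N) (HalfIntegral.vectorRep ε),
      ∀ f : HalfIntegral.plusSpace N k ξ,
        (L f : UpperHalfPlane → Fin 2 → ℂ) = HalfIntegral.lift ε (f : UpperHalfPlane → ℂ)) ∧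
    ∀ χ : DirichletCharacter ℂ N, χ (-1) = ((ξ : ℤ) : ℂ) →
      HalfIntegral.lift ε ''
          (HalfIntegral.plusSpaceChar N k ξ χ : Set (UpperHalfPlane → ℂ)) =
        (HalfIntegral.autForms (2 * k + 1) (HalfIntegral.Gamma0t N)
          (fun A => HalfIntegral.charVal χ A • HalfIntegral.vectorRep ε A) :
          Set (UpperHalfPlane → Fin 2 → ℂ)) := by

  refine ⟨fun f hf => ⟨fun τ => ?_, fun r τ => ?_⟩, ?_, fun χ hχ => ?_⟩
  · exact HalfIntegral.hasSum_fourierC hf.1.1 (HalfIntegral.T_invariant_of_mem_plusSpace hf) τ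
  · exact HalfIntegral.summable_fourierPartTerm hf.1.1
      (HalfIntegral.T_invariant_of_mem_plusSpace hf) r τ
  · exact ⟨LinearEquiv.ofBijective _ (HalfIntegral.liftLinear_bijective N k hε), fun f => rfl⟩
  · refine Set.Subset.antisymm ?_ fun F hF => ?_
    · rintro _ ⟨f, hf, rfl⟩
      exact HalfIntegral.lift_mem_char hε hχ hf
    · obtain ⟨h1, h2⟩ := HalfIntegral.descend_mem_char hε hχ hF
      exact ⟨_, h2, HalfIntegral.lift_descend h1.1 (HalfIntegral.T_equivariant_of_mem h1)⟩
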